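/- Throughout, a system $A$ of linear equations is $A'x=a$ with an integer matrix $A'$ (the underlying matrix, of any dimensions) and an integer vector $a$; for an integer matrix $M$ we also speak of the homogeneous system $Mx=0$. A solution is \emph{distinct} if its entries are pairwise distinct; a system (or a matrix $M$, via $Mx=0$) is \emph{irredundant} if it has a distinct solution in the positive integers. A set $S$ is $(A,B)$-\emph{Rado} if for every red/blue colouring of $S$ there is a distinct solution of $A$ in $S$ that is entirely red or a distinct solution of $B$ in $S$ that is entirely blue. $[n]_p$ is the random subset of $\{1,\dots,n\}$ containing each element independently with probability $p$. For a matrix $M$ with column set $[q]$ and $W\subseteq[q]$, let $M_{\overline W}$ consist of the columns outside $W$ (rank $0$ if there are none), and put $$m(M)=\max_{|W|\ge 2}\frac{|W|-1}{|W|-1+\operatorname{rank}(M_{\overline W})-\operatorname{rank}(M)},\qquad m(M,N)=\max_{|W|\ge 2}\frac{|W|}{|W|-1+\operatorname{rank}(M_{\overline W})-\operatorname{rank}(M)+1/m(N)}.$$ For systems, $m(A,B):=m(A',B')$. $M$ satisfies $(*)$ if no matrix obtained from $M$ by rational elementary row operations has a row with exactly two non-zero entries. An $\ell\times k$ matrix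 $C$ of rank $\ell$ is \emph{strictly balanced} if $\frac{|W|-1}{|W|-1+\operatorname{rank}(C_{\overline W})-\ell}<\frac{k-1}{k-1-\ell}$ for all $W\subseteq[k]$ with $2\le|W|<k$. A \emph{core} of $M$ is an integer matrix $C$ that is obtained from $M$ by rational elementary row operations followed by deleting rows and columns, where the remaining rows are zero in the deleted columns, and that is irredundant, of full rank, strictly balanced and satisfies $m(C)=m(M)$. \textbf{Theorem.} Let $k,\ell$ be positive integers with $k\ge \ell+2$. There is a constant $c>0$ (depending only on $k$ and $\ell$) such that the following holds. Let $A$ and $B$ be systems of linear equations such that $A$, $B$ and their underlying matrices are irredundant, both underlying matrices satisfy $(*)$, and both underlying matrices have a core of dimension $\ell\times k$. Then $\frac1{m(A,B)}=\frac{k-\ell-1}{k-1}$, and if $p=p(n)\in[0,1]$ satisfies $$p\le c\,n^{-1/m(A,B)}=c\,n^{-\frac{k-\ell-1}{k-1}}$$ for all sufficiently large $n$, then $\lim_{n\to\infty}\mathbb P\big[[n]_p\text{ is }(A,B)\text{-Rado}\big]=0$. -/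

import Mathlib

open Filter Topology

/-- A finite system of linear equations `matrix * x = rhs` with integer coefficients; `matrix` is
the underlying matrix of the system. -/
structure LinearSystem where
  rows : ℕ
  cols : ℕ
  matrix : Matrix (Fin rows) (Fin cols) ℤ
  rhs : Fin rows → ℤ

namespace LinearSystem

/-- The homogeneous system `M x = 0`. -/
def homogeneous {ℓ k : ℕ} (M : Matrix (Fin ℓ) (Fin k) ℤ) : LinearSystem := ⟨ℓ, k, M, 0⟩

/-- `x` is a solution of the system `A` in `S` whose entries are pairwise distinct. -/
def IsDistinctSolution (A : LinearSystem) (S : Set ℕ) (x : Fin A.cols → ℕ) : Prop :=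
  (∀ j, x j ∈ S) ∧ Function.Injective x ∧ A.matrix.mulVec (fun j => (x j : ℤ)) = A.rhs

/-- There is a solution with pairwise distinct entries in the positive integers. -/
def Irredundant (A : LinearSystem) : Prop :=
  ∃ x : Fin A.cols → ℕ, A.IsDistinctSolution (Set.Ioi 0) x

/-- `S` is `(A₁, …, A_r)`-Rado: every `r`-colouring of `S` yields, for some `i`, a solution of `A i`
in `S` with pairwise distinct entries, all of colour `i`. (Colourings of `S` are given as restrictions
of colourings of `ℕ`.) -/
def IsRado {r : ℕ} (A : Fin r → LinearSystem) (S : Set ℕ) : Prop :=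
  ∀ χ : ℕ → Fin r, ∃ i, ∃ x : Fin (A i).cols → ℕ,
    (A i).IsDistinctSolution S x ∧ ∀ j, χ (x j) = i

end LinearSystem

namespace RadoMatrix

/-- The integer matrix `M` with its entries read as rationals. -/
def toRat {ℓ k : ℕ} (M : Matrix (Fin ℓ) (Fin k) ℤ) : Matrix (Fin ℓ) (Fin k) ℚ :=
  M.map (fun z : ℤ => (z : ℚ))

/-- The rank of `M`. -/
noncomputable def rk {ℓ k : ℕ} (M : Matrix (Fin ℓ) (Fin k) ℤ) : ℕ := (toRat M).rank

/-- The rank of the matrix formed by the columns of `M` that are not indexed by `W`. -/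
noncomputable def rkCompl {ℓ k : ℕ} (M : Matrix (Fin ℓ) (Fin k) ℤ) (W : Finset (Fin k)) : ℕ :=
  ((toRat M).submatrix id (fun j : {j : Fin k // j ∉ W} => (j : Fin k))).rank

/-- `m(M)`, the maximum over all `W` with `|W| ≥ 2` of
`(|W| - 1) / (|W| - 1 + rank(M_{Wᶜ}) - rank(M))`. -/
noncomputable def m {ℓ k : ℕ} (M : Matrix (Fin ℓ) (Fin k) ℤ) : ℝ :=
  ⨆ W : {W : Finset (Fin k) // 2 ≤ W.card},
    ((W.1.card : ℝ) - 1) / ((W.1.card : ℝ) - 1 + (rkCompl M W.1 : ℝ) - (rk M : ℝ))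

/-- `m(M, N)`, the maximum over all sets `W` of columns of `M` with `|W| ≥ 2` of
`|W| / (|W| - 1 + rank(M_{Wᶜ}) - rank(M) + 1 / m(N))`. -/
noncomputable def mPair {ℓ k ℓ' k' : ℕ} (M : Matrix (Fin ℓ) (Fin k) ℤ)
    (N : Matrix (Fin ℓ') (Fin k') ℤ) : ℝ :=
  ⨆ W : {W : Finset (Fin k) // 2 ≤ W.card},
    (W.1.card : ℝ) /
      ((W.1.card : ℝ) - 1 + (rkCompl M W.1 : ℝ) - (rk M : ℝ) + 1 / m N)

/-- Property `(*)`: no matrix obtained from `M` by (invertible, rational) row operations has a row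
with exactly two nonzero entries. -/
def PropertyStar {ℓ k : ℕ} (M : Matrix (Fin ℓ) (Fin k) ℤ) : Prop :=
  ∀ U : Matrix (Fin ℓ) (Fin ℓ) ℚ, IsUnit U →
    ∀ i, (Finset.univ.filter fun j => (U * toRat M) i j ≠ 0).card ≠ 2

/-- An `ℓ × k` matrix of full (row) rank is strictly balanced if
`(|W| - 1) / (|W| - 1 + rank(M_{Wᶜ}) - ℓ) < (k - 1) / (k - 1 - ℓ)` whenever `2 ≤ |W| < k`. -/
def StrictlyBalanced {ℓ k : ℕ} (M : Matrix (Fin ℓ) (Fin k) ℤ) : Prop :=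
  rk M = ℓ ∧ ∀ W : Finset (Fin k), 2 ≤ W.card → W.card < k →
    ((W.card : ℝ) - 1) / ((W.card : ℝ) - 1 + (rkCompl M W : ℝ) - (ℓ : ℝ)) <
      ((k : ℝ) - 1) / ((k : ℝ) - 1 - (ℓ : ℝ))

/-- `C` is a core of `M`: after row operations on `M` one keeps the rows `ρ` and the columns `σ`,
where the rows kept vanish on the deleted columns (so that deleting these columns keeps valid
equations), and the resulting matrix `C` is irredundant, strictly balanced (in particular of full
rank) and satisfies `m(C) = m(M)`. -/
def IsCore {ℓ' k' ℓ k : ℕ} (M : Matrix (Fin ℓ') (Fin k') ℤ) (C : Matrix (Fin ℓ) (Fin k) ℤ) :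
    Prop :=
  (∃ U : Matrix (Fin ℓ') (Fin ℓ') ℚ, IsUnit U ∧
    ∃ (ρ : Fin ℓ ↪o Fin ℓ') (σ : Fin k ↪o Fin k'),
      toRat C = (U * toRat M).submatrix ρ σ ∧
      ∀ i, ∀ j, j ∉ Set.range σ → (U * toRat M) (ρ i) j = 0) ∧
  (LinearSystem.homogeneous C).Irredundant ∧ StrictlyBalanced C ∧ m C = m M

end RadoMatrix

/-!
Every solution of a system restricts to a solution of a linear system with its core as matrix. So a
Rado set `S` yields an unavoidable family of coloured hyperedges, namely the core solutions in `S`: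
every colouring of `S` makes one of them monochromatic in its own colour. In a minimal such family
every vertex `v` of every edge `e` lies on a second edge, of another colour, that meets `e` in `v`
only. Following these edges, one finds a simple path of length `L`, or a connected union of `O(L)`
edges whose overlaps cost more than `ℓ` in total. The only other outcome is a triangle, for `k = 3`,
and the edges inside its vertex set can be avoided by hand.

Paths and costly unions are excluded by a first moment computation with `L = ⌈log n⌉`. Extending a
path by one edge multiplies the expected number of paths by at most `exp (-1)`, once `c` is small. A
single edge has expectation of order `n ^ (ℓ / (k - 1))`, and every unit of cost gains a factor `n ^
(-1 / (k - 1))`; by strict balance, an edge that meets what is already explored in more than one but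
not all of its vertices costs at least one unit.
-/

namespace RadoHypergraph

section Explorations

variable {α E : Type*} [DecidableEq α]

/-- Explorations of a hypergraph with edge set `H`, where `V e` is the vertex set of the edge `e`:
edges are added one at a time. `Exploration V F H s r q X e` says that after `s` edges, `r` of them
added freely, with total cost `q`, the explored vertex set is `X` and the last edge is `e`. A free
step only has to meet the explored set `X`, and costs `F e (V e ∩ X)`; any other step is without
cost, but has to meet `X` in exactly one vertex, which lies in the previous edge. -/
inductive Exploration (V : E → Finset α) (F : E → Finset α → ℕ) (H : Set E) :
    ℕ → ℕ → ℕ → Finset α → E → Prop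
  | start (e : E) (he : e ∈ H) : Exploration V F H 1 0 0 (V e) e
  | ext {s r q : ℕ} {X : Finset α} {e : E} (h : Exploration V F H s r q X e) (e' : E)
      (he' : e' ∈ H) (hcard : (V e' ∩ X).card = 1) (hlast : (V e' ∩ V e).Nonempty) :
      Exploration V F H (s + 1) r q (X ∪ V e') e'
  | free {s r q : ℕ} {X : Finset α} {e : E} (h : Exploration V F H s r q X e) (e' : E)
      (he' : e' ∈ H) (hmeet : (V e' ∩ X).Nonempty) :
      Exploration V F H (s + 1) (r + 1) (q + F e' (V e' ∩ X)) (X ∪ V e') e'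

/-- The union of the vertex sets of the first `r` edges `e 0, …, e (r - 1)` of a sequence. -/
def unionBefore (V : E → Finset α) (e : ℕ → E) (r : ℕ) : Finset α :=
  (Finset.range r).biUnion fun j => V (e j)

/-- A simple path `e 0, …, e t`: consecutive edges share one vertex, all others are disjoint. -/
structure IsSimplePath (V : E → Finset α) (H : Set E) (e : ℕ → E) (t : ℕ) : Prop where
  mem : ∀ i ≤ t, e i ∈ H
  link : ∀ i < t, (V (e (i + 1)) ∩ V (e i)).card = 1
  disj : ∀ i j, i + 1 < j → j ≤ t → Disjoint (V (e j)) (V (e i))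

variable {V : E → Finset α} {F : E → Finset α → ℕ} {H : Set E} {e : ℕ → E} {s r q t : ℕ}
  {X T : Finset α}

theorem mem_unionBefore {v : α} : v ∈ unionBefore V e r ↔ ∃ j < r, v ∈ V (e j) := by
  simp [unionBefore]

theorem subset_unionBefore {j : ℕ} (hj : j < r) : V (e j) ⊆ unionBefore V e r :=
  fun _ hv => mem_unionBefore.2 ⟨j, hj, hv⟩

theorem unionBefore_succ : unionBefore V e (r + 1) = unionBefore V e r ∪ V (e r) := by
  rw [unionBefore, Finset.range_add_one, Finset.biUnion_insert, Finset.union_comm]; rfl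

theorem unionBefore_zero : unionBefore V e 0 = ∅ := rfl

theorem unionBefore_one : unionBefore V e 1 = V (e 0) := by
  rw [unionBefore_succ, unionBefore_zero, Finset.empty_union]

theorem Exploration.subset {x : E} (h : Exploration V F H s r q X x) {S : Set α}
    (hS : ∀ e ∈ H, (V e : Set α) ⊆ S) : (X : Set α) ⊆ S := by
  induction h with
  | start e he => exact hS e he
  | ext h e' he' _ _ ih => simpa using ⟨ih, hS e' he'⟩
  | free h e' he' _ ih => simpa using ⟨ih, hS e' he'⟩

theorem Exploration.mono {H' : Set E} (hH : H ⊆ H') {x : E} (h : Exploration V F H s r q X x) :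
    Exploration V F H' s r q X x := by
  induction h with
  | start e he => exact .start e (hH he)
  | ext _ e' he' hcard hlast ih => exact .ext ih e' (hH he') hcard hlast
  | free _ e' he' hmeet ih => exact .free ih e' (hH he') hmeet

theorem Exploration.last_subset {x : E} (h : Exploration V F H s r q X x) : V x ⊆ X := by
  cases h with
  | start => exact Finset.Subset.refl _
  | ext | free => exact Finset.subset_union_right

theorem isSimplePath_zero {x : E} (hx : x ∈ H) : IsSimplePath V H (fun _ => x) 0 :=
  ⟨fun _ _ => hx, fun _ hi => absurd hi (by omega), fun _ _ _ _ => by omega⟩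

namespace IsSimplePath

theorem rev (h : IsSimplePath V H e t) : IsSimplePath V H (fun j => e (t - j)) t where
  mem i hi := h.mem _ (by omega)
  link i hi := by
    have := h.link (t - (i + 1)) (by omega)
    rwa [show t - (i + 1) + 1 = t - i by omega, Finset.inter_comm] at this
  disj i j hij hj := (h.disj (t - j) (t - i) (by omega) (by omega)).symm

theorem shift (h : IsSimplePath V H e t) {i t' : ℕ} (hi : i + t' ≤ t) :
    IsSimplePath V H (fun j => e (i + j)) t' where
  mem j hj := h.mem _ (by omega)
  link j hj := h.link (i + j) (by omega)
  disj j j' hij hj := h.disj (i + j) (i + j') (by omega) (by omega)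

theorem take (h : IsSimplePath V H e t) {t' : ℕ} (ht : t' ≤ t) : IsSimplePath V H e t' where
  mem j hj := h.mem _ (by omega)
  link j hj := h.link j (by omega)
  disj j j' hij hj := h.disj j j' hij (by omega)

theorem append (h : IsSimplePath V H e t) {g : E} (hg : g ∈ H)
    (hlink : (V g ∩ V (e t)).card = 1) (hdisj : ∀ j < t, Disjoint (V g) (V (e j))) :
    IsSimplePath V H (fun j => if j ≤ t then e j else g) (t + 1) where
  mem j _ := by
    split_ifs with hjt
    · exact h.mem _ hjt
    · exact hg
  link j hj := by
    rw [if_pos (show j ≤ t by omega)]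
    split_ifs with hjt
    · exact h.link j hjt
    · rwa [show j = t by omega]
  disj i j hij hj := by
    rw [if_pos (show i ≤ t by omega)]
    split_ifs with hjt
    · exact h.disj i j hij hjt
    · exact hdisj i (by omega)

theorem inter_unionBefore (h : IsSimplePath V H e (t + 1)) :
    V (e (t + 1)) ∩ unionBefore V e (t + 1) = V (e (t + 1)) ∩ V (e t) := by
  refine subset_antisymm (fun v hv => ?_)
    (Finset.inter_subset_inter_left (subset_unionBefore t.lt_succ_self))
  obtain ⟨hvt, hv⟩ := Finset.mem_inter.1 hv
  obtain ⟨j, hj, hvj⟩ := mem_unionBefore.1 hv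
  obtain rfl | hjt : j = t ∨ j < t := by omega
  · exact Finset.mem_inter.2 ⟨hvt, hvj⟩
  · exact absurd hvj (Finset.disjoint_left.1 (h.disj j (t + 1) (by omega) le_rfl) hvt)

theorem card_inter_unionBefore (h : IsSimplePath V H e (t + 1)) :
    (V (e (t + 1)) ∩ unionBefore V e (t + 1)).card = 1 := by
  rw [h.inter_unionBefore, h.link t t.lt_succ_self]

end IsSimplePath

theorem Exploration.walk (h : IsSimplePath V H e t) (hX : Exploration V F H s r q X (e 0))
    (hdisj : ∀ j, 0 < j → j ≤ t → V (e j) ∩ X ⊆ V (e 0)) :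
    Exploration V F H (s + t) r q (X ∪ unionBefore V e (t + 1)) (e t) := by
  induction t with
  | zero => rwa [unionBefore_one, Finset.union_eq_left.2 hX.last_subset]
  | succ t ih =>
    have hinter : V (e (t + 1)) ∩ (X ∪ unionBefore V e (t + 1)) =
        V (e (t + 1)) ∩ unionBefore V e (t + 1) := by
      rw [Finset.inter_union_distrib_left, Finset.union_eq_right]
      exact Finset.subset_inter Finset.inter_subset_left
        ((hdisj _ t.succ_pos le_rfl).trans (subset_unionBefore t.succ_pos))
    rw [unionBefore_succ, ← Finset.union_assoc]
    refine .ext (ih (h.take (by omega)) fun j hj hjt => hdisj j hj (by omega)) _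
      (h.mem _ le_rfl) ?_ ?_
    · rw [hinter, h.card_inter_unionBefore]
    · exact Finset.card_pos.1 (by rw [h.link t t.lt_succ_self]; exact one_pos)

theorem IsSimplePath.exploration (h : IsSimplePath V H e t) (F : E → Finset α → ℕ) :
    Exploration V F H (1 + t) 0 0 (unionBefore V e (t + 1)) (e t) := by
  have := Exploration.walk (F := F) h (.start (e 0) (h.mem 0 t.zero_le))
    fun j _ _ => Finset.inter_subset_right
  rwa [Finset.union_eq_right.2 (subset_unionBefore t.succ_pos)] at this

theorem Exploration.attach_path {x : E} (hT : Exploration V F H s r q T x)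
    (h : IsSimplePath V H e t) (hmeet : (V (e 0) ∩ T).Nonempty)
    (hdisj : ∀ j, 0 < j → j ≤ t → Disjoint (V (e j)) T) :
    Exploration V F H (s + 1 + t) (r + 1) (q + F (e 0) (V (e 0) ∩ T))
      (T ∪ unionBefore V e (t + 1)) (e t) := by
  have := (hT.free (e 0) (h.mem 0 t.zero_le) hmeet).walk h fun j hj hjt => by
    rw [Finset.inter_union_distrib_left, Finset.disjoint_iff_inter_eq_empty.1 (hdisj j hj hjt),
      Finset.empty_union]
    exact Finset.inter_subset_right
  rwa [Finset.union_assoc, Finset.union_eq_right.2 (subset_unionBefore t.succ_pos)] at this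

end Explorations

section Sparse

variable {α E : Type*} [DecidableEq α]

/-- A `k`-uniform hypergraph in which every edge meets, at each of its vertices, another edge in
that vertex only, in which short explorations with few free steps cost at most `ℓ`, and in which
explorations without free steps have at most `L` edges. The cost of a free step is positive unless
the new edge meets the explored set in one vertex or in all of its vertices, and it is at least `ℓ`
if they meet in two vertices. -/
structure IsSparse (V : E → Finset α) (F : E → Finset α → ℕ) (H : Set E) (k ℓ L : ℕ) : Prop where
  three_le : 3 ≤ k
  pos : 1 ≤ ℓ
  card : ∀ e ∈ H, (V e).card = k
  cost_pair : ∀ e ∈ H, ∀ I ⊆ V e, I.card = 2 → ℓ ≤ F e I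
  cost_pos : ∀ e ∈ H, ∀ I ⊆ V e, 2 ≤ I.card → I.card < k → 1 ≤ F e I
  cheap : ∀ s r q X e, Exploration V F H s r q X e → s ≤ 2 * L + 10 → r ≤ 4 → q ≤ ℓ
  short : ∀ q X e, ¬ Exploration V F H (1 + L) 0 q X e
  private_edge : ∀ e ∈ H, ∀ v ∈ V e, ∃ e' ∈ H, V e' ∩ V e = {v}

/-- A simple path `e 0, …, e t` attached to the vertex set `T`: its first edge meets `T` in one
vertex, and the other edges avoid `T`. -/
structure IsAnchoredPath (V : E → Finset α) (H : Set E) (T : Finset α) (e : ℕ → E) (t : ℕ) :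
    Prop where
  path : IsSimplePath V H e t
  card_inter : (V (e 0) ∩ T).card = 1
  disj : ∀ j, 0 < j → j ≤ t → Disjoint (V (e j)) T

variable {V : E → Finset α} {F : E → Finset α → ℕ} {H : Set E} {e : ℕ → E} {s r q t : ℕ}
  {X T : Finset α} {k ℓ L : ℕ}

namespace IsAnchoredPath

theorem exploration (h : IsAnchoredPath V H T e t) {x : E} (hT : Exploration V F H s r q T x) :
    ∃ s' ≤ s + t, ∃ r' ≤ r + 1, ∃ q' ≥ q, ∃ x',
      Exploration V F H s' r' q' (T ∪ unionBefore V e t) x' := by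
  cases t with
  | zero =>
    rw [unionBefore_zero, Finset.union_empty]
    exact ⟨s, le_rfl, r, by omega, q, le_rfl, x, hT⟩
  | succ t =>
    have hmeet : (V (e 0) ∩ T).Nonempty := Finset.card_pos.1 (by rw [h.card_inter]; exact one_pos)
    exact ⟨_, by omega, _, le_rfl, _, Nat.le_add_right _ _, _, hT.attach_path
      (h.path.take t.le_succ) hmeet fun j hj hjt => h.disj j hj (by omega)⟩

theorem card_last_inter (h : IsAnchoredPath V H T e t) :
    (V (e t) ∩ (T ∪ unionBefore V e t)).card = 1 := by
  cases t with
  | zero => rw [unionBefore_zero, Finset.union_empty, h.card_inter]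
  | succ t =>
    rw [Finset.inter_union_distrib_left,
      Finset.disjoint_iff_inter_eq_empty.1 (h.disj _ t.succ_pos le_rfl), Finset.empty_union,
      h.path.card_inter_unionBefore]

theorem append (h : IsAnchoredPath V H T e t) {g : E} (hg : g ∈ H)
    (hlink : (V g ∩ V (e t)).card = 1) (hdisj : Disjoint (V g) (T ∪ unionBefore V e t)) :
    IsAnchoredPath V H T (fun j => if j ≤ t then e j else g) (t + 1) where
  path := h.path.append hg hlink fun _ hj =>
    hdisj.mono_right ((subset_unionBefore hj).trans Finset.subset_union_right)
  card_inter := by simpa using h.card_inter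
  disj j hj _ := by
    split_ifs with hjt
    · exact h.disj j hj hjt
    · exact hdisj.mono_right Finset.subset_union_left

end IsAnchoredPath

namespace IsSparse

theorem lt_of_isSimplePath (hS : IsSparse V F H k ℓ L) (h : IsSimplePath V H e t) : t < L := by
  by_contra! hlt
  exact hS.short _ _ _ ((h.take hlt).exploration F)

theorem cost_lt_of_two_le_card_inter (hS : IsSparse V F H k ℓ L) {x g : E}
    (hX : Exploration V F H s r q X x) (hs : s < 2 * L + 10) (hr : r < 4) (hg : g ∈ H)
    (hcard : 2 ≤ (V g ∩ X).card) (hsub : ¬ V g ⊆ X) : q < ℓ := by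
  have hlt : (V g ∩ X).card < k := by
    rw [← hS.card g hg]
    exact Finset.card_lt_card ⟨Finset.inter_subset_left,
      fun hle => hsub (hle.trans Finset.inter_subset_right)⟩
  have hpos := hS.cost_pos g hg _ Finset.inter_subset_left hcard hlt
  have hle := hS.cheap _ _ _ _ _ (hX.free g hg (Finset.card_pos.1 (by omega))) hs hr
  omega

theorem cost_eq_zero_of_card_inter_eq_two (hS : IsSparse V F H k ℓ L) {x g : E}
    (hX : Exploration V F H s r q X x) (hs : s < 2 * L + 10) (hr : r < 4) (hg : g ∈ H)
    (hcard : (V g ∩ X).card = 2) : q = 0 := by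
  have hge := hS.cost_pair g hg _ Finset.inter_subset_left hcard
  have hle := hS.cheap _ _ _ _ _ (hX.free g hg (Finset.card_pos.1 (by omega))) hs hr
  omega

theorem exists_mem_notMem_of_card_inter_le_two (hS : IsSparse V F H k ℓ L) {g : E} (hg : g ∈ H)
    (hcard : (V g ∩ X).card ≤ 2) : ∃ v ∈ V g, v ∉ X := by
  obtain ⟨v, hv, hvX⟩ : ∃ v ∈ V g, v ∉ V g ∩ X :=
    Finset.exists_mem_notMem_of_card_lt_card (by have := hS.three_le; rw [hS.card g hg]; omega)
  exact ⟨v, hv, fun h => hvX (Finset.mem_inter.2 ⟨hv, h⟩)⟩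

theorem exists_longest_path (hS : IsSparse V F H k ℓ L) {P : (ℕ → E) → ℕ → Prop}
    (hP : ∀ e t, P e t → IsSimplePath V H e t) (hne : ∃ e t, P e t) :
    ∃ e t, P e t ∧ ∀ e' t', P e' t' → t' ≤ t := by
  classical
  have hbound : ∀ t, (∃ e, P e t) → t ≤ L := fun t ⟨e, he⟩ => (hS.lt_of_isSimplePath (hP e t he)).le
  obtain ⟨e₀, t₀, h₀⟩ := hne
  obtain ⟨e, he⟩ := Nat.findGreatest_spec (P := fun t => ∃ e, P e t) (hbound _ ⟨e₀, h₀⟩) ⟨e₀, h₀⟩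
  exact ⟨e, _, he, fun e' t' h' => Nat.le_findGreatest (hbound _ ⟨e', h'⟩) ⟨e', h'⟩⟩

/-- Otherwise exploring `g`, then the path from `e 0` on, pays for `e 0` and again for `e (t + 1)`,
which meets its predecessor and `g`. -/
theorem card_inter_le_one (hS : IsSparse V F H k ℓ L) (h : IsSimplePath V H e (t + 1)) {g : E}
    (hg : g ∈ H) {v : α} (hlast : V g ∩ V (e (t + 1)) = {v}) (hv : v ∉ V (e 0))
    (hmid : ∀ j, 0 < j → j < t + 1 → Disjoint (V g) (V (e j))) : (V g ∩ V (e 0)).card ≤ 1 := by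
  by_contra! hfat
  rw [Finset.inter_comm] at hfat
  obtain ⟨hvg, hvt⟩ : v ∈ V g ∧ v ∈ V (e (t + 1)) := by
    rw [← Finset.mem_inter, hlast, Finset.mem_singleton]
  have he0 := h.mem 0 (Nat.zero_le _)
  have hexp := (Exploration.start (V := V) (F := F) g hg).attach_path (h.take t.le_succ)
    (Finset.card_pos.1 (by omega)) fun j hj hjt => (hmid j hj (by omega)).symm
  have hvt' : v ∉ V (e t) := by
    rcases Nat.eq_zero_or_pos t with rfl | ht
    · exact hv
    · exact Finset.disjoint_left.1 (hmid t ht t.lt_succ_self) hvg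
  have htwo : (V (e (t + 1)) ∩ (V g ∪ unionBefore V e (t + 1))).card = 2 := by
    rw [Finset.inter_union_distrib_left, Finset.inter_comm _ (V g), hlast, h.inter_unionBefore,
      Finset.card_union_of_disjoint (by simp [hvt']), h.link t t.lt_succ_self,
      Finset.card_singleton]
  have htL := hS.lt_of_isSimplePath h
  have hfree := hS.cost_eq_zero_of_card_inter_eq_two hexp (by omega) (by omega)
    (h.mem _ le_rfl) htwo
  have hnotfull : (V (e 0) ∩ V g).card < k := by
    rw [← hS.card g hg]
    exact Finset.card_lt_card ⟨Finset.inter_subset_right,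
      fun hsub => hv (Finset.mem_inter.1 (hsub hvg)).1⟩
  have hpaid := hS.cost_pos _ he0 _ Finset.inter_subset_left hfat hnotfull
  omega

/-- A longest path attached to `T` cannot be continued at a free vertex of its last edge, so the
private edge there meets the explored set again, which is too expensive. -/
theorem not_isAnchoredPath (hS : IsSparse V F H k ℓ L) {x : E}
    (hT : Exploration V F H s r q T x) (hs : s ≤ L + 2) (hr : r ≤ 1) (hq : ℓ ≤ q) (e : ℕ → E)
    (t : ℕ) : ¬ IsAnchoredPath V H T e t := by
  intro hanchored
  obtain ⟨f, u, hf, hmax⟩ := hS.exists_longest_path (P := IsAnchoredPath V H T)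
    (fun _ _ h => h.path) ⟨e, t, hanchored⟩
  obtain ⟨s', hs', r', hr', q', hq', x', hX⟩ := hf.exploration hT
  set X := T ∪ unionBefore V f u
  have hfu := hf.path.mem u le_rfl
  have huL := hS.lt_of_isSimplePath hf.path
  have hone : (V (f u) ∩ X).card = 1 := hf.card_last_inter
  obtain ⟨v, hv, hvX⟩ := hS.exists_mem_notMem_of_card_inter_le_two hfu
    (hone.le.trans one_le_two)
  obtain ⟨y, hy, hyv⟩ := hS.private_edge _ hfu v hv
  have hvy : v ∈ V y := (Finset.mem_inter.1 (hyv ▸ Finset.mem_singleton_self v)).1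
  have hmeet : (V y ∩ X).Nonempty := by
    rw [← Finset.not_disjoint_iff_nonempty_inter]
    intro hdisj
    have := hmax _ _ (hf.append hy (by rw [hyv, Finset.card_singleton]) hdisj)
    omega
  rcases Nat.lt_or_ge 1 (V y ∩ X).card with hfat | _
  · have := hS.cost_lt_of_two_le_card_inter hX (by omega) (by omega) hy hfat
      fun hsub => hvX (hsub hvy)
    omega
  · have htwo : (V (f u) ∩ (X ∪ V y)).card = 2 := by
      rw [Finset.inter_union_distrib_left, Finset.inter_comm _ (V y), hyv,
        Finset.card_union_of_disjoint (by simp [hvX]), hone, Finset.card_singleton]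
    have := hS.cost_eq_zero_of_card_inter_eq_two (hX.free y hy hmeet) (by omega) (by omega) hfu htwo
    have := hS.pos
    omega

theorem subset_of_meets (hS : IsSparse V F H k ℓ L) {x : E} (hT : Exploration V F H s r q T x)
    (hs : s ≤ L + 2) (hr : r ≤ 1) (hq : ℓ ≤ q) {z : E} (hz : z ∈ H)
    (hmeet : (V z ∩ T).Nonempty) : V z ⊆ T := by
  by_contra hsub
  refine hS.not_isAnchoredPath hT hs hr hq (fun _ => z) 0
    ⟨isSimplePath_zero hz, le_antisymm ?_ (Finset.card_pos.2 hmeet), fun _ _ _ => by omega⟩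
  by_contra! hfat
  have := hS.cost_lt_of_two_le_card_inter hT (by omega) (by omega) hz hfat hsub
  omega

end IsSparse

end Sparse

section Cycles

variable {α E : Type*} [DecidableEq α]

/-- A simple cycle: a simple path `e 0, …, e t` of at least two edges, closed by an edge `g` that
meets it in a vertex `a` of the first and a vertex `b` of the last edge. -/
structure IsSimpleCycle (V : E → Finset α) (H : Set E) (e : ℕ → E) (t : ℕ) (g : E) (a b : α) :
    Prop where
  path : IsSimplePath V H e t
  pos : 0 < t
  mem : g ∈ H
  first : V g ∩ V (e 0) = {a}
  last : V g ∩ V (e t) = {b}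
  ne : a ≠ b
  mid : ∀ j, 0 < j → j < t → Disjoint (V g) (V (e j))

variable {V : E → Finset α} {F : E → Finset α → ℕ} {H : Set E} {e : ℕ → E} {t : ℕ} {g z : E}
  {a b : α} {k ℓ L : ℕ}

namespace IsSimpleCycle

theorem rev (h : IsSimpleCycle V H e t g a b) : IsSimpleCycle V H (fun j => e (t - j)) t g b a where
  path := h.path.rev
  pos := h.pos
  mem := h.mem
  first := by simpa using h.last
  last := by simpa using h.first
  ne := h.ne.symm
  mid j _ _ := h.mid _ (by omega) (by omega)

theorem inter_unionBefore (h : IsSimpleCycle V H e t g a b) :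
    V g ∩ unionBefore V e (t + 1) = {a, b} := by
  refine subset_antisymm (fun v hv => ?_) ?_
  · obtain ⟨hvg, hv⟩ := Finset.mem_inter.1 hv
    obtain ⟨j, hj, hvj⟩ := mem_unionBefore.1 hv
    obtain rfl | rfl | ⟨hj0, hjt⟩ : j = 0 ∨ j = t ∨ 0 < j ∧ j < t := by omega
    · have : v ∈ ({a} : Finset α) := h.first ▸ Finset.mem_inter.2 ⟨hvg, hvj⟩
      exact Finset.mem_insert.2 (Or.inl (Finset.mem_singleton.1 this))
    · exact Finset.mem_insert_of_mem (h.last ▸ Finset.mem_inter.2 ⟨hvg, hvj⟩)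
    · exact absurd hvj (Finset.disjoint_left.1 (h.mid j hj0 hjt) hvg)
  · rw [Finset.insert_eq, ← h.first, ← h.last]
    exact Finset.union_subset
      (Finset.inter_subset_inter_left (subset_unionBefore t.succ_pos))
      (Finset.inter_subset_inter_left (subset_unionBefore t.lt_succ_self))

theorem card_inter_unionBefore (h : IsSimpleCycle V H e t g a b) :
    (V g ∩ unionBefore V e (t + 1)).card = 2 := by
  rw [h.inter_unionBefore, Finset.card_pair h.ne]

end IsSimpleCycle

namespace IsSparse

theorem subset_of_meets_cycle (hS : IsSparse V F H k ℓ L) (h : IsSimpleCycle V H e t g a b)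
    (hz : z ∈ H) (hmeet : (V z ∩ (unionBefore V e (t + 1) ∪ V g)).Nonempty) :
    V z ⊆ unionBefore V e (t + 1) ∪ V g := by
  have htwo := h.card_inter_unionBefore
  have hexp := (h.path.exploration F).free g h.mem (Finset.card_pos.1 (by omega))
  have htL := hS.lt_of_isSimplePath h.path
  have hcost := hS.cost_pair g h.mem _ Finset.inter_subset_left htwo
  exact hS.subset_of_meets hexp (by omega) (by omega) (by omega) hz hmeet

theorem exists_isSimpleCycle_of_meets (hS : IsSparse V F H k ℓ L)
    (h : IsSimplePath V H e (t + 1)) (hg : g ∈ H) (hlast : V g ∩ V (e (t + 1)) = {b})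
    (hb : b ∉ V (e 0)) (hmid : ∀ j, 0 < j → j < t + 1 → Disjoint (V g) (V (e j)))
    (hmeet : (V g ∩ V (e 0)).Nonempty) : ∃ a, IsSimpleCycle V H e (t + 1) g a b := by
  obtain ⟨a, ha⟩ := Finset.card_eq_one.1
    (le_antisymm (hS.card_inter_le_one h hg hlast hb hmid) (Finset.card_pos.2 hmeet))
  refine ⟨a, h, t.succ_pos, hg, ha, hlast, ?_, hmid⟩
  rintro rfl
  exact hb (Finset.mem_inter.1 (ha ▸ Finset.mem_singleton_self a)).2

theorem exists_cycle_of_meets_path (hS : IsSparse V F H k ℓ L) (h : IsSimplePath V H e t)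
    (hg : g ∈ H) (hlast : V g ∩ V (e t) = {b}) (hb : b ∉ unionBefore V e t)
    (hmeet : ¬ Disjoint (V g) (unionBefore V e t)) :
    ∃ e t g a b, IsSimpleCycle V H e t g a b := by
  classical
  let meets j := j < t ∧ ¬ Disjoint (V g) (V (e j))
  obtain ⟨i, hit, hi, hmax⟩ : ∃ i < t, ¬ Disjoint (V g) (V (e i)) ∧
      ∀ j, i < j → j < t → Disjoint (V g) (V (e j)) := by
    simp only [unionBefore, Finset.disjoint_biUnion_right, Finset.mem_range, not_forall] at hmeet
    obtain ⟨j, hj, hgj⟩ := hmeet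
    obtain ⟨hit, hi⟩ := Nat.findGreatest_spec (P := meets) hj.le ⟨hj, hgj⟩
    exact ⟨_, hit, hi, fun j' hj' hj't => by_contra fun hcon =>
      Nat.findGreatest_is_greatest hj' hj't.le ⟨hj't, hcon⟩⟩
  obtain ⟨u, rfl⟩ : ∃ u, t = i + (u + 1) := ⟨t - i - 1, by omega⟩
  obtain ⟨a, hcycle⟩ := hS.exists_isSimpleCycle_of_meets (h.shift le_rfl) hg hlast
    (fun hb' => hb (subset_unionBefore hit hb')) (fun j hj hju => hmax _ (by omega) (by omega))
    (Finset.not_disjoint_iff_nonempty_inter.1 hi)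
  exact ⟨_, _, _, _, _, hcycle⟩

theorem exists_cycle (hS : IsSparse V F H k ℓ L) (hne : H.Nonempty) :
    ∃ e t g a b, IsSimpleCycle V H e t g a b := by
  obtain ⟨x, hx⟩ := hne
  obtain ⟨e, t, h, hmax⟩ := hS.exists_longest_path (P := IsSimplePath V H) (fun _ _ h => h)
    ⟨fun _ => x, 0, isSimplePath_zero hx⟩
  have het := h.mem t le_rfl
  have hthin : (V (e t) ∩ unionBefore V e t).card ≤ 2 := by
    cases t with
    | zero => simp [unionBefore_zero]
    | succ t => rw [h.card_inter_unionBefore]; omega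
  obtain ⟨v, hv, hvfree⟩ := hS.exists_mem_notMem_of_card_inter_le_two het hthin
  obtain ⟨g, hg, hgv⟩ := hS.private_edge _ het v hv
  refine hS.exists_cycle_of_meets_path h hg hgv hvfree fun hdisj => ?_
  have := hmax _ _ (h.append hg (by rw [hgv, Finset.card_singleton])
    fun j hj => hdisj.mono_right (subset_unionBefore hj))
  omega

theorem exists_cycle_of_meets_cycle (hS : IsSparse V F H k ℓ L)
    (h : IsSimpleCycle V H e t g a b) (hz : z ∈ H) {w : α} (hzg : V z ∩ V g = {w})
    (hw : ∀ j ≤ t, w ∉ V (e j)) {i : ℕ} (hi : i < t) (hmeet : ¬ Disjoint (V z) (V (e i)))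
    (hmin : ∀ j < i, Disjoint (V z) (V (e j))) :
    (V z ∩ V (e i)).card = 1 ∧ ∃ f x, IsSimpleCycle V H f (i + 1) z x w := by
  have hfirst : V g ∩ V (e (i - i)) = {a} := by simpa using h.first
  have hpath := (h.path.take hi.le).rev.append h.mem (by rw [hfirst, Finset.card_singleton])
    fun j hj => h.mid _ (by omega) (by omega)
  obtain ⟨x, hcycle⟩ := hS.exists_isSimpleCycle_of_meets hpath hz (by simpa using hzg)
    (by simpa using hw i hi.le)
    (fun j hj hji => by rw [if_pos (by omega)]; exact hmin _ (by omega))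
    (by simpa [Finset.not_disjoint_iff_nonempty_inter] using hmeet)
  have hx : V z ∩ V (e i) = {x} := by simpa using hcycle.first
  exact ⟨by rw [hx, Finset.card_singleton], _, x, hcycle⟩

theorem disjoint_or_card_inter_eq_one (hS : IsSparse V F H k ℓ L)
    (h : IsSimpleCycle V H e t g a b)
    (hshortest : ∀ e' t' g' a' b', IsSimpleCycle V H e' t' g' a' b' → t ≤ t') (hz : z ∈ H) {w : α}
    (hzg : V z ∩ V g = {w}) (hw : ∀ j ≤ t, w ∉ V (e j)) {j : ℕ} (hj : j < t) :
    Disjoint (V z) (V (e j)) ∨ j + 1 = t ∧ (V z ∩ V (e j)).card = 1 := by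
  classical
  by_contra! hcon
  have hex : ∃ j, ¬ Disjoint (V z) (V (e j)) := ⟨j, hcon.1⟩
  have hle : Nat.find hex ≤ j := Nat.find_min' hex hcon.1
  obtain ⟨hone, f, x, hf⟩ := hS.exists_cycle_of_meets_cycle h hz hzg hw (hle.trans_lt hj)
    (Nat.find_spec hex) fun i hi => not_not.1 (Nat.find_min hex hi)
  have hlong := hshortest _ _ _ _ _ hf
  obtain hjt : Nat.find hex = j := by omega
  exact hcon.2 (by omega) (hjt ▸ hone)

theorem card_le_of_shortest_cycle (hS : IsSparse V F H k ℓ L)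
    (h : IsSimpleCycle V H e (t + 1) g a b)
    (hshortest : ∀ e' t' g' a' b', IsSimpleCycle V H e' t' g' a' b' → t + 1 ≤ t') (hz : z ∈ H)
    {w : α} (hzg : V z ∩ V g = {w}) (hw : ∀ j ≤ t + 1, w ∉ V (e j)) :
    k ≤ (V z ∩ V (e t)).card + (V z ∩ V (e (t + 1))).card + 1 := by
  have hsub : V z ⊆ insert w ((V z ∩ V (e t)) ∪ (V z ∩ V (e (t + 1)))) := by
    intro v hv
    obtain ⟨hwz, hwg⟩ := Finset.mem_inter.1 (hzg ▸ Finset.mem_singleton_self w)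
    have hvT := hS.subset_of_meets_cycle h hz
      ⟨w, Finset.mem_inter.2 ⟨hwz, Finset.mem_union_right _ hwg⟩⟩ hv
    rcases Finset.mem_union.1 hvT with hvpath | hvg
    · obtain ⟨j, hj, hvj⟩ := mem_unionBefore.1 hvpath
      have hmeet : ¬ Disjoint (V z) (V (e j)) := Finset.not_disjoint_iff.2 ⟨v, hv, hvj⟩
      obtain rfl | rfl : j = t ∨ j = t + 1 := by
        by_contra! hcon
        have := (hS.disjoint_or_card_inter_eq_one h hshortest hz hzg hw
          (by omega)).resolve_left hmeet
        omega
      all_goals simp [hv, hvj]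
    · have : v ∈ V z ∩ V g := Finset.mem_inter.2 ⟨hv, hvg⟩
      exact Finset.mem_insert.2 (Or.inl (Finset.mem_singleton.1 (hzg ▸ this)))
  rw [← hS.card z hz]
  exact (Finset.card_le_card hsub).trans ((Finset.card_insert_le _ _).trans
    (Nat.add_le_add_right (Finset.card_union_le _ _) 1))

/-- The private edge at a vertex of `g` off the path is contained in the cycle. If the cycle is
shortest, `disjoint_or_card_inter_eq_one` from both ends of the path leaves room for its three or
more vertices only if the path has just two edges. -/
theorem exists_triangle (hS : IsSparse V F H k ℓ L) (hne : H.Nonempty) :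
    k = 3 ∧ ∃ e g a b, IsSimpleCycle V H e 1 g a b := by
  classical
  have hex : ∃ t e g a b, IsSimpleCycle V H e t g a b := by
    obtain ⟨e, t, g, a, b, h⟩ := hS.exists_cycle hne
    exact ⟨t, e, g, a, b, h⟩
  obtain ⟨e, g, a, b, h⟩ := Nat.find_spec hex
  have hshortest : ∀ e' t' g' a' b', IsSimpleCycle V H e' t' g' a' b' → Nat.find hex ≤ t' :=
    fun e' t' g' a' b' h' => Nat.find_min' hex ⟨e', g', a', b', h'⟩
  obtain ⟨t, ht⟩ : ∃ t, Nat.find hex = t + 1 := Nat.exists_eq_succ_of_ne_zero h.pos.ne'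
  rw [ht] at h hshortest
  obtain ⟨w, hwg, hwpath⟩ :=
    hS.exists_mem_notMem_of_card_inter_le_two h.mem h.card_inter_unionBefore.le
  have hw : ∀ j ≤ t + 1, w ∉ V (e j) := fun j hj hwj =>
    hwpath (subset_unionBefore (Nat.lt_succ_of_le hj) hwj)
  obtain ⟨z, hz, hzg⟩ := hS.private_edge g h.mem w hwg
  have hcard := hS.card_le_of_shortest_cycle h hshortest hz hzg hw
  have h3 := hS.three_le
  have hnear : (V z ∩ V (e t)).card ≤ 1 := by
    rcases hS.disjoint_or_card_inter_eq_one h hshortest hz hzg hw t.lt_succ_self with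
      hdisj | ⟨-, hone⟩
    · simp [Finset.disjoint_iff_inter_eq_empty.1 hdisj]
    · exact hone.le
  have hfar : Disjoint (V z) (V (e (t + 1))) ∨ t = 0 ∧ (V z ∩ V (e (t + 1))).card = 1 := by
    simpa [eq_comm] using hS.disjoint_or_card_inter_eq_one h.rev hshortest hz hzg
      (fun j _ => hw _ (by omega)) t.succ_pos
  rcases hfar with hdisj | ⟨rfl, hone⟩
  · rw [Finset.disjoint_iff_inter_eq_empty.1 hdisj, Finset.card_empty] at hcard
    omega
  · exact ⟨by omega, e, g, a, b, h⟩

end IsSparse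

end Cycles

section Unavoidable

variable {α E κ : Type*}

/-- A family `H` of coloured edges is unavoidable if every colouring of the vertices makes some edge
of `H` monochromatic in its own colour. -/
def IsUnavoidable (V : E → Finset α) (col : E → κ) (H : Set E) : Prop :=
  ∀ χ : α → κ, ∃ e ∈ H, ∀ v ∈ V e, χ v = col e

variable {V : E → Finset α} {col : E → κ} {H : Set E} {e : E}

theorem exists_minimal_isUnavoidable (hfin : H.Finite) (hH : IsUnavoidable V col H) :
    ∃ H' ⊆ H, Minimal (IsUnavoidable V col) H' := by
  obtain ⟨H', hle, hmin⟩ := (hfin.finite_subsets.inter_of_left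
    {H' | IsUnavoidable V col H'}).exists_le_minimal (a := H) ⟨Set.Subset.refl H, hH⟩
  exact ⟨H', hle, hmin.prop.2, fun H'' hH'' hsub => hmin.2 ⟨hsub.trans hle, hH''⟩ hsub⟩

theorem exists_unique_monochromatic (hH : Minimal (IsUnavoidable V col) H) (he : e ∈ H) :
    ∃ χ : α → κ, (∀ v ∈ V e, χ v = col e) ∧ ∀ e' ∈ H, (∀ v ∈ V e', χ v = col e') → e' = e := by
  have hnot : ¬ IsUnavoidable V col (H \ {e}) := fun h =>
    (hH.le_of_le h Set.sdiff_subset he).2 rfl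
  simp only [IsUnavoidable, not_forall, not_exists, not_and] at hnot
  obtain ⟨χ, hχ⟩ := hnot
  have honly : ∀ e' ∈ H, (∀ v ∈ V e', χ v = col e') → e' = e := fun e' he' hmono =>
    by_contra fun hne => by
      obtain ⟨v, hv, hvcol⟩ := hχ e' ⟨he', hne⟩
      exact hvcol (hmono v hv)
  obtain ⟨e', he', hmono⟩ := hH.prop χ
  exact ⟨χ, honly e' he' hmono ▸ hmono, honly⟩

variable [DecidableEq α]

theorem exists_inter_eq_singleton [Nontrivial κ] (hH : Minimal (IsUnavoidable V col) H)
    (he : e ∈ H) {v : α} (hv : v ∈ V e) : ∃ e' ∈ H, V e' ∩ V e = {v} := by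
  obtain ⟨χ, hχe, honly⟩ := exists_unique_monochromatic hH he
  obtain ⟨c, hc⟩ := exists_ne (col e)
  obtain ⟨e', he', hmono⟩ := hH.prop (Function.update χ v c)
  have hve' : v ∈ V e' := by
    by_contra hcon
    obtain rfl : e' = e := honly e' he' fun u hu => by
      rw [← hmono u hu, Function.update_of_ne (by rintro rfl; exact hcon hu)]
    exact hcon hv
  have hcol : c = col e' := by rw [← hmono v hve', Function.update_self]
  refine ⟨e', he', Finset.eq_singleton_iff_unique_mem.2 ⟨Finset.mem_inter.2 ⟨hve', hv⟩, ?_⟩⟩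
  intro u hu
  obtain ⟨hue', hue⟩ := Finset.mem_inter.1 hu
  by_contra huv
  apply hc
  rw [hcol, ← hmono u hue', Function.update_of_ne huv, hχe u hue]

theorem exists_monochromatic_subset (hH : Minimal (IsUnavoidable V col) H) {T : Finset α}
    (hT : ∀ z ∈ H, (V z ∩ T).Nonempty → V z ⊆ T) (he : e ∈ H) (heT : (V e ∩ T).Nonempty)
    (χ : α → κ) : ∃ z ∈ H, V z ⊆ T ∧ ∀ v ∈ V z, χ v = col z := by
  obtain ⟨χ', -, honly⟩ := exists_unique_monochromatic hH he
  obtain ⟨z, hz, hmono⟩ := hH.prop (T.piecewise χ χ')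
  by_cases hzT : (V z ∩ T).Nonempty
  · have hsub := hT z hz hzT
    refine ⟨z, hz, hsub, fun v hv => ?_⟩
    rw [← hmono v hv, Finset.piecewise_eq_of_mem _ _ _ (hsub hv)]
  · obtain rfl : z = e := honly z hz fun v hv => by
      rw [← hmono v hv, Finset.piecewise_eq_of_notMem _ _ _ fun hvT =>
        hzT ⟨v, Finset.mem_inter.2 ⟨hv, hvT⟩⟩]
    exact absurd heT hzT

namespace IsSparse

variable {F : E → Finset α → ℕ} {k ℓ L : ℕ} {x y z : E} {u : α}

theorem card_inter_ne_one (hS : IsSparse V F H k ℓ L) (hx : x ∈ H) (hy : y ∈ H) (hz : z ∈ H)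
    (hxy : V y ∩ V x = {u}) (hu : u ∉ V z) (hzx : (V z ∩ V x).card = 2) :
    (V z ∩ V y).card ≠ 1 := by
  intro hzy
  have htwo : (V y ∩ (V x ∪ V z)).card = 2 := by
    rw [Finset.inter_union_distrib_left, hxy, Finset.card_union_of_disjoint (by simp [hu]),
      Finset.inter_comm (V y), hzy, Finset.card_singleton]
  have hfree := hS.cost_eq_zero_of_card_inter_eq_two
    ((Exploration.start x hx).free z hz (Finset.card_pos.1 (by omega)))
    (by omega) (by omega) hy htwo
  have hpaid := hS.cost_pair z hz _ Finset.inter_subset_left hzx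
  have := hS.pos
  omega

theorem mem_of_subset_union (hS : IsSparse V F H 3 ℓ L) (hx : x ∈ H) (hy : y ∈ H) (hz : z ∈ H)
    (hxy : V y ∩ V x = {u}) (hsub : V z ⊆ V x ∪ V y) : u ∈ V z := by
  by_contra hu
  obtain ⟨huy, hux⟩ := Finset.mem_inter.1 (hxy ▸ Finset.mem_singleton_self u)
  have hdisj : Disjoint (V z ∩ V x) (V z ∩ V y) := by
    rw [Finset.disjoint_left]
    intro v hvx hvy
    have : v ∈ V y ∩ V x :=
      Finset.mem_inter.2 ⟨(Finset.mem_inter.1 hvy).2, (Finset.mem_inter.1 hvx).2⟩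
    exact hu (Finset.mem_singleton.1 (hxy ▸ this) ▸ (Finset.mem_inter.1 hvx).1)
  have hsum : (V z ∩ V x).card + (V z ∩ V y).card = 3 := by
    rw [← Finset.card_union_of_disjoint hdisj, ← Finset.inter_union_distrib_left,
      Finset.inter_eq_left.2 hsub, hS.card z hz]
  have hlt : ∀ p ∈ H, u ∈ V p → (V z ∩ V p).card < 3 := fun p hp hup => by
    rw [← hS.card p hp]
    exact Finset.card_lt_card ⟨Finset.inter_subset_right,
      fun hle => hu (Finset.mem_inter.1 (hle hup)).1⟩
  have hltx := hlt x hx hux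
  have hlty := hlt y hy huy
  have hx2 := hS.card_inter_ne_one hx hy hz hxy hu
  have hy2 := hS.card_inter_ne_one hy hx hz (Finset.inter_comm (V y) _ ▸ hxy) hu
  omega

/-- In the triangle given by `exists_triangle`, let `y` be the common vertex of the two path edges
and `w` the vertex of the closing edge off the path. Giving `y` and `w` one colour and the remaining
vertices another one leaves no edge inside the triangle monochromatic. -/
theorem not_minimal_isUnavoidable [Nontrivial κ] (hS : IsSparse V F H k ℓ L) :
    ¬ Minimal (IsUnavoidable V col) H := by
  classical
  intro hH
  obtain ⟨c, c', hcc'⟩ := exists_pair_ne κ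
  obtain ⟨rfl, e, g, a, b, h⟩ := hS.exists_triangle (by
    obtain ⟨e, he, -⟩ := hH.prop fun _ => c
    exact ⟨e, he⟩)
  obtain ⟨y, hy⟩ := Finset.card_eq_one.1 (h.path.link 0 one_pos)
  have hoff : (V g \ unionBefore V e 2).card = 1 := by
    have := Finset.card_sdiff_add_card_inter (V g) (unionBefore V e 2)
    rw [hS.card g h.mem, h.card_inter_unionBefore] at this
    omega
  obtain ⟨w, hw⟩ := Finset.card_eq_one.1 hoff
  obtain ⟨hwg, -⟩ := Finset.mem_sdiff.1 (hw ▸ Finset.mem_singleton_self w)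
  obtain ⟨z, hz, hzT, hmono⟩ := exists_monochromatic_subset hH
    (fun z hz => hS.subset_of_meets_cycle h hz) h.mem
    ⟨w, Finset.mem_inter.2 ⟨hwg, Finset.mem_union_right _ hwg⟩⟩
    (fun v => if v ∈ ({y, w} : Finset α) then c else c')
  by_cases hdisj : Disjoint (V z) {y, w}
  · rw [Finset.disjoint_right] at hdisj
    refine hdisj (Finset.mem_insert_self y {w})
      (hS.mem_of_subset_union (h.path.mem 0 zero_le_one) (h.path.mem 1 le_rfl) hz hy fun v hv => ?_)
    rw [show V (e 0) ∪ V (e 1) = unionBefore V e 2 by rw [unionBefore_succ, unionBefore_one]]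
    by_contra hvpath
    have hvw : v ∈ V g \ unionBefore V e 2 :=
      Finset.mem_sdiff.2 ⟨(Finset.mem_union.1 (hzT hv)).resolve_left hvpath, hvpath⟩
    exact hdisj (Finset.mem_insert_of_mem (hw ▸ hvw)) hv
  · obtain ⟨v, hv, hvc⟩ := Finset.not_disjoint_iff.1 hdisj
    have hcol : c = col z := by rw [← hmono v hv, if_pos hvc]
    have hsub : V z ⊆ {y, w} := fun v hv => by
      by_contra hvc
      exact hcc' (hcol.trans (by rw [← hmono v hv, if_neg hvc]))
    have := (Finset.card_le_card hsub).trans Finset.card_le_two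
    have := hS.card z hz
    omega

end IsSparse

end Unavoidable

end RadoHypergraph

namespace RadoMatrix

section Field

variable {K ι κ : Type*} [Field K] [Fintype ι] (M : Matrix κ ι K)

theorem exists_linearIndepOn_col_card_eq_rank :
    ∃ B : Finset ι, B.card = M.rank ∧ LinearIndepOn K M.col B := by
  classical
  obtain ⟨B, -, -, hspan, hli⟩ := exists_linearIndepOn_extension (v := M.col)
    (linearIndepOn_empty K _) (Set.empty_subset (Set.univ : Set ι))
  have hrange : Submodule.span K (M.col '' B) = Submodule.span K (Set.range M.col) :=
    le_antisymm (Submodule.span_mono (Set.image_subset_range _ _))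
      (Submodule.span_le.2 (by rwa [← Set.image_univ]))
  refine ⟨B.toFinset, ?_, by rwa [Set.coe_toFinset]⟩
  rw [Matrix.rank_eq_finrank_span_cols, ← hrange, Set.toFinset_card, Set.image_eq_range]
  exact (finrank_span_eq_card hli).symm

variable {M}

theorem eq_of_mulVec_eq_of_eqOn_compl {B : Finset ι} (hB : LinearIndepOn K M.col B) {x y : ι → K}
    (hM : M.mulVec x = M.mulVec y) (hxy : ∀ i ∉ B, x i = y i) : x = y := by
  have hsum : ∑ i ∈ B, (x - y) i • M.col i = 0 := by
    rw [Finset.sum_subset B.subset_univ fun i _ hi => by simp [hxy i hi]]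
    ext r
    have hr := congrFun (sub_eq_zero.2 hM) r
    rw [← Matrix.mulVec_sub] at hr
    simpa [Matrix.mulVec, dotProduct, mul_comm] using hr
  funext i
  by_cases hi : i ∈ B
  · exact sub_eq_zero.1 (linearIndepOn_finset_iff.1 hB _ hsum i hi)
  · exact hxy i hi

theorem card_solutions_le {α : Type*} {f : α → K} (hf : Function.Injective f) {A : Finset α}
    {s : Finset (ι → α)} (hA : ∀ x ∈ s, ∀ i, x i ∈ A)
    (hM : ∀ x ∈ s, ∀ y ∈ s, M.mulVec (f ∘ x) = M.mulVec (f ∘ y)) :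
    s.card ≤ A.card ^ (Fintype.card ι - M.rank) := by
  classical
  obtain ⟨B, hB, hli⟩ := exists_linearIndepOn_col_card_eq_rank M
  have hcard : (Fintype.piFinset fun _ : {i // i ∉ B} => A).card =
      A.card ^ (Fintype.card ι - M.rank) := by
    simp [Fintype.card_piFinset, ← hB, Fintype.card_subtype_compl]
  rw [← hcard]
  refine Finset.card_le_card_of_injOn (fun x i => x i.1)
    (fun x hx => Fintype.mem_piFinset.2 fun i => hA x hx i) fun x hx y hy hxy => ?_
  exact hf.comp_left (eq_of_mulVec_eq_of_eqOn_compl hli (hM x hx y hy)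
    fun i hi => congrArg f (congrFun hxy ⟨i, hi⟩))

theorem card_solutions_eqOn_le [DecidableEq ι] {α : Type*} {f : α → K} (hf : Function.Injective f)
    {A : Finset α} {s : Finset (ι → α)} (hA : ∀ x ∈ s, ∀ i, x i ∈ A)
    (hM : ∀ x ∈ s, ∀ y ∈ s, M.mulVec (f ∘ x) = M.mulVec (f ∘ y)) {J : Finset ι}
    (hJ : ∀ x ∈ s, ∀ y ∈ s, ∀ i ∈ J, x i = y i) :
    s.card ≤ A.card ^
      (Fintype.card ι - J.card - (M.submatrix id fun j : {j // j ∉ J} => (j : ι)).rank) := by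
  let restrict (x : ι → α) (i : {j // j ∉ J}) : α := x i
  have hinj : Set.InjOn restrict s := by
    intro x hx y hy hxy
    funext i
    by_cases hi : i ∈ J
    · exact hJ x hx y hy i hi
    · exact congrFun hxy ⟨i, hi⟩
  classical
  rw [← Finset.card_image_of_injOn hinj, ← Fintype.card_coe J, ← Fintype.card_subtype_compl]
  refine card_solutions_le hf ?_ ?_
  · exact Finset.forall_mem_image.2 fun x hx i => hA x hx i
  · refine Finset.forall_mem_image.2 fun x hx => Finset.forall_mem_image.2 fun y hy => ?_
    ext r
    have hr := congrFun (hM x hx y hy) r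
    simp only [Matrix.mulVec, dotProduct, Function.comp_apply] at hr
    rw [← Fintype.sum_subtype_add_sum_subtype (· ∈ J),
      ← Fintype.sum_subtype_add_sum_subtype (· ∈ J) fun i => M r i * f (y i)] at hr
    refine add_left_cancel (Eq.trans (congrArg (· + _) (Finset.sum_congr rfl fun i _ => ?_)) hr)
    rw [hJ x hx y hy i i.2]

theorem card_solutions_mem_le [DecidableEq ι] {α : Type*} {f : α → K} (hf : Function.Injective f)
    {A : Finset α} {s : Finset (ι → α)} (hA : ∀ x ∈ s, ∀ i, x i ∈ A)
    (hM : ∀ x ∈ s, ∀ y ∈ s, M.mulVec (f ∘ x) = M.mulVec (f ∘ y)) {J : Finset ι} {Y : Finset α}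
    (hJ : ∀ x ∈ s, ∀ i ∈ J, x i ∈ Y) :
    s.card ≤ Y.card ^ J.card * A.card ^
      (Fintype.card ι - J.card - (M.submatrix id fun j : {j // j ∉ J} => (j : ι)).rank) := by
  classical
  let restrict (x : ι → α) (i : J) : α := x i
  have hcard : (Fintype.piFinset fun _ : J => Y).card = Y.card ^ J.card := by simp
  rw [← hcard, mul_comm]
  refine Finset.card_le_mul_card_image_of_maps_to (f := restrict)
    (fun x hx => Fintype.mem_piFinset.2 fun i => hJ x hx i i.2) _ fun v _ => ?_
  have hfibre : ∀ x ∈ s.filter fun x => restrict x = v, x ∈ s ∧ ∀ i (hi : i ∈ J), x i = v ⟨i, hi⟩ :=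
    fun x hx => (Finset.mem_filter.1 hx).imp_right fun h i hi => congrFun h ⟨i, hi⟩
  refine card_solutions_eqOn_le hf (fun x hx => hA x (hfibre x hx).1)
    (fun x hx y hy => hM x (hfibre x hx).1 y (hfibre y hy).1) fun x hx y hy i hi => ?_
  rw [(hfibre x hx).2 i hi, (hfibre y hy).2 i hi]

theorem exists_vecMul_ne_zero [Fintype κ] {Z : Set ι}
    (hZ : Module.finrank K (Submodule.span K (M.col '' Z)) < M.rank) :
    ∃ c : κ → K, (∀ j ∈ Z, Matrix.vecMul c M j = 0) ∧ ∃ j, Matrix.vecMul c M j ≠ 0 := by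
  classical
  obtain ⟨q, hq⟩ : ∃ q, M.col q ∉ Submodule.span K (M.col '' Z) := by
    by_contra! hall
    have hle : Submodule.span K (Set.range M.col) ≤ Submodule.span K (M.col '' Z) :=
      Submodule.span_le.2 (Set.range_subset_iff.2 hall)
    have := Submodule.finrank_mono hle
    rw [← Matrix.rank_eq_finrank_span_cols] at this
    exact hZ.not_ge this
  obtain ⟨φ, hφq, hφ⟩ := Submodule.exists_dual_map_eq_bot_of_notMem hq inferInstance
  obtain ⟨c, rfl⟩ := (dotProductEquiv K κ).surjective φ
  refine ⟨c, fun j hj => ?_, q, hφq⟩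
  have hmem := Submodule.mem_map_of_mem (f := dotProductEquiv K κ c)
    (Submodule.subset_span (Set.mem_image_of_mem M.col hj))
  rw [hφ] at hmem
  exact (Submodule.mem_bot K).1 hmem

end Field

section Integer

variable {ℓ k ℓ' k' : ℕ} {M : Matrix (Fin ℓ) (Fin k) ℤ} {C : Matrix (Fin ℓ') (Fin k') ℤ}
  {W W' : Finset (Fin k)}

/-- The form of property `(*)` that only involves the row space: no rational combination of the rows
of `M` has exactly two nonzero entries. -/
def RowStar (M : Matrix (Fin ℓ) (Fin k) ℤ) : Prop :=
  ∀ c : Fin ℓ → ℚ, (Finset.univ.filter fun j => Matrix.vecMul c (toRat M) j ≠ 0).card ≠ 2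

theorem PropertyStar.rowStar (h : PropertyStar M) : RowStar M := by
  intro c hc
  have hne : c ≠ 0 := by
    rintro rfl
    simp at hc
  obtain ⟨i, hi⟩ : ∃ i, c i ≠ 0 := Function.ne_iff.1 hne
  have hdet : ((1 : Matrix (Fin ℓ) (Fin ℓ) ℚ).updateRow i c).det = c i := by
    rw [← Matrix.cramer_transpose_apply]
    simp
  refine h ((1 : Matrix (Fin ℓ) (Fin ℓ) ℚ).updateRow i c) ?_ i ?_
  · rw [Matrix.isUnit_iff_isUnit_det, hdet]
    exact isUnit_iff_ne_zero.2 hi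
  · simpa only [Matrix.mul_apply_eq_vecMul, Matrix.updateRow_self] using hc

theorem IsCore.rowStar (hC : IsCore M C) (h : RowStar M) : RowStar C := by
  obtain ⟨⟨U, -, ρ, σ, hCU, hzero⟩, -⟩ := hC
  intro c hc
  have hcomb : Matrix.vecMul (Matrix.vecMul c (U.submatrix ρ id)) (toRat M) =
      Matrix.vecMul c ((U * toRat M).submatrix ρ id) := by
    rw [Matrix.vecMul_vecMul, Matrix.submatrix_mul _ _ ρ id id Function.bijective_id,
      Matrix.submatrix_id_id]
  refine h (Matrix.vecMul c (U.submatrix ρ id)) ?_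
  rw [hcomb, ← hc, ← Finset.card_map σ.toEmbedding]
  congr 1
  ext j
  by_cases hj : j ∈ Set.range σ
  · obtain ⟨i, rfl⟩ := hj
    have hci : Matrix.vecMul c ((U * toRat M).submatrix ρ id) (σ i) =
        Matrix.vecMul c (toRat C) i := by
      rw [hCU]
      rfl
    have hmem : σ i ∈ (Finset.univ.filter fun j => Matrix.vecMul c (toRat C) j ≠ 0).map
        σ.toEmbedding ↔ Matrix.vecMul c (toRat C) i ≠ 0 := by
      simp
    rw [hmem, Finset.mem_filter, hci, and_iff_right (Finset.mem_univ _)]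
  · have hcj : Matrix.vecMul c ((U * toRat M).submatrix ρ id) j = 0 := by
      simp only [Matrix.vecMul, dotProduct]
      exact Finset.sum_eq_zero fun i _ => by simp [hzero i j hj]
    simpa [hcj] using fun i _ hij => hj ⟨i, hij⟩

theorem rkCompl_eq_finrank_span (M : Matrix (Fin ℓ) (Fin k) ℤ) (W : Finset (Fin k)) :
    rkCompl M W = Module.finrank ℚ (Submodule.span ℚ ((toRat M).col '' (W : Set (Fin k))ᶜ)) := by
  rw [rkCompl, Matrix.rank_eq_finrank_span_cols, Set.image_eq_range]
  rfl

theorem rkCompl_anti (M : Matrix (Fin ℓ) (Fin k) ℤ) (h : W ⊆ W') :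
    rkCompl M W' ≤ rkCompl M W := by
  rw [rkCompl_eq_finrank_span, rkCompl_eq_finrank_span]
  exact Submodule.finrank_mono (Submodule.span_mono (Set.image_mono (Set.compl_subset_compl.2 h)))

theorem rkCompl_le_rk (M : Matrix (Fin ℓ) (Fin k) ℤ) (W : Finset (Fin k)) : rkCompl M W ≤ rk M :=
  Matrix.rank_submatrix_le _ _ _

theorem rkCompl_univ (M : Matrix (Fin ℓ) (Fin k) ℤ) : rkCompl M Finset.univ = 0 := by
  rw [rkCompl_eq_finrank_span]
  simp

theorem rkCompl_le_rkCompl_add_card_sdiff (M : Matrix (Fin ℓ) (Fin k) ℤ) (W W' : Finset (Fin k)) :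
    rkCompl M W ≤ rkCompl M W' + (W' \ W).card := by
  classical
  have hsub : (W : Set (Fin k))ᶜ ⊆ (W' : Set (Fin k))ᶜ ∪ ↑(W' \ W) := fun j hj => by
    by_cases hj' : j ∈ W' <;> simp_all
  have hspan := Submodule.span_mono (R := ℚ) (Set.image_mono (f := (toRat M).col) hsub)
  rw [Set.image_union, Submodule.span_union, ← Finset.coe_image] at hspan
  rw [rkCompl_eq_finrank_span, rkCompl_eq_finrank_span]
  refine (Submodule.finrank_mono hspan).trans
    ((Submodule.finrank_add_le_finrank_add_finrank _ _).trans (Nat.add_le_add_left ?_ _))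
  exact (finrank_span_finset_le_card _).trans Finset.card_image_le

theorem exists_pos_mulVec_eq_zero (hirr : (LinearSystem.homogeneous M).Irredundant) :
    ∃ x : Fin k → ℚ, (∀ j, 0 < x j) ∧ (toRat M).mulVec x = 0 := by
  obtain ⟨x, hpos, -, hx⟩ := hirr
  refine ⟨fun j => x j, fun j => Nat.cast_pos.2 (hpos j), ?_⟩
  ext r
  have := congrFun hx r
  simp only [LinearSystem.homogeneous, Matrix.mulVec, dotProduct, Pi.zero_apply] at this ⊢
  simp only [toRat, Matrix.map_apply]
  exact_mod_cast this

/-- If the rank dropped, some row combination would be supported on `{i, j}`; being orthogonal to a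
positive vector, it would have exactly two nonzero entries. -/
theorem rkCompl_pair (h : RowStar M) (hirr : (LinearSystem.homogeneous M).Irredundant)
    {i j : Fin k} (hij : i ≠ j) : rkCompl M {i, j} = rk M := by
  refine le_antisymm (rkCompl_le_rk M _) (not_lt.1 fun hlt => ?_)
  obtain ⟨x, hpos, hx⟩ := exists_pos_mulVec_eq_zero hirr
  rw [rkCompl_eq_finrank_span] at hlt
  obtain ⟨c, hzero, q, hq⟩ := exists_vecMul_ne_zero hlt
  set u := Matrix.vecMul c (toRat M) with hu
  have hsupp : ∀ p, p ∉ ({i, j} : Finset (Fin k)) → u p = 0 := fun p hp => hzero p hp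
  have horth : u i * x i + u j * x j = 0 := by
    rw [← Finset.sum_pair (f := fun p => u p * x p) hij,
      Finset.sum_subset (Finset.subset_univ _) fun p _ hp => by rw [hsupp p hp, zero_mul]]
    change u ⬝ᵥ x = 0
    rw [hu, ← Matrix.dotProduct_mulVec, hx, dotProduct_zero]
  have hiff : u i = 0 ↔ u j = 0 := by
    constructor <;> intro h0 <;> simpa [h0, (hpos _).ne'] using horth
  have hqij : q = i ∨ q = j := by
    by_contra! hcon
    exact hq (hsupp q (by simp [hcon]))
  have hne : u i ≠ 0 ∧ u j ≠ 0 := by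
    rcases hqij with rfl | rfl
    · exact ⟨hq, mt hiff.2 hq⟩
    · exact ⟨mt hiff.1 hq, hq⟩
  refine h c ?_
  rw [← Finset.card_pair hij]
  congr 1
  ext p
  by_cases hp : p ∈ ({i, j} : Finset (Fin k))
  · simp only [Finset.mem_filter, Finset.mem_univ, true_and, hp, iff_true]
    rcases Finset.mem_insert.1 hp with rfl | hp
    · exact hne.1
    · exact (Finset.mem_singleton.1 hp) ▸ hne.2
  · simpa [hp] using hsupp p hp

theorem rk_add_two_le (h : RowStar M) (hirr : (LinearSystem.homogeneous M).Irredundant)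
    (hW : 2 ≤ W.card) : rk M + 2 ≤ W.card + rkCompl M W := by
  obtain ⟨i, hi, j, hj, hij⟩ := Finset.one_lt_card.1 hW
  have hsub : {i, j} ⊆ W := Finset.insert_subset hi (Finset.singleton_subset_iff.2 hj)
  have hdrop := rkCompl_le_rkCompl_add_card_sdiff M {i, j} W
  rw [rkCompl_pair h hirr hij, Finset.card_sdiff_of_subset hsub, Finset.card_pair hij] at hdrop
  omega

/-- The numerical conditions on an `ℓ × k` core that govern the number of its solutions with some
prescribed entries: prescribing one or two entries does not lower the rank, and prescribing the
entries in `W` with `2 ≤ |W| < k` lowers it by less than `ℓ (|W| - 1) / (k - 1)`. -/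
structure IsTight (C : Matrix (Fin ℓ) (Fin k) ℤ) : Prop where
  rkCompl_of_card_eq_one : ∀ W : Finset (Fin k), W.card = 1 → rkCompl C W = ℓ
  rkCompl_of_card_eq_two : ∀ W : Finset (Fin k), W.card = 2 → rkCompl C W = ℓ
  balanced : ∀ W : Finset (Fin k), 2 ≤ W.card → W.card < k →
    (k - 1) * ℓ < (W.card - 1) * ℓ + (k - 1) * rkCompl C W

/-- The exponent, in units of `n ^ (-1 / (k - 1))`, by which prescribing the entries of a solution
at the positions `J` makes it rarer than prescribing a single entry. By `IsTight.le_add_mul_rkCompl`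
the subtraction does not truncate. -/
noncomputable def positionCost (C : Matrix (Fin ℓ) (Fin k) ℤ) (J : Finset (Fin k)) : ℕ :=
  (J.card - 1) * ℓ + (k - 1) * rkCompl C J - (k - 1) * ℓ

namespace IsTight

theorem rkCompl_empty (hM : IsTight M) (hk : 0 < k) : rkCompl M ∅ = ℓ := by
  refine le_antisymm ((rkCompl_le_rk M ∅).trans (Matrix.rank_le_height _)) ?_
  exact (hM.rkCompl_of_card_eq_one {⟨0, hk⟩} (Finset.card_singleton _)).ge.trans
    (rkCompl_anti M (Finset.empty_subset _))

theorem positionCost_of_card_eq_one (hM : IsTight M) (hW : W.card = 1) : positionCost M W = 0 := by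
  simp [positionCost, hW, hM.rkCompl_of_card_eq_one W hW]

theorem positionCost_of_card_eq_two (hM : IsTight M) (hW : W.card = 2) : positionCost M W = ℓ := by
  simp [positionCost, hW, hM.rkCompl_of_card_eq_two W hW]

theorem positionCost_pos (hM : IsTight M) (hW2 : 2 ≤ W.card) (hWk : W.card < k) :
    0 < positionCost M W :=
  Nat.sub_pos_of_lt (hM.balanced W hW2 hWk)

theorem le_add_mul_rkCompl (hM : IsTight M) (hW : W.Nonempty) :
    (k - 1) * ℓ ≤ (W.card - 1) * ℓ + (k - 1) * rkCompl M W := by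
  have hWk : W.card ≤ k := (Finset.card_le_univ W).trans_eq (Fintype.card_fin k)
  rcases hWk.lt_or_eq with hlt | heq
  · rcases (Nat.succ_le_of_lt hW.card_pos).eq_or_lt' with h1 | h2
    · exact (hM.rkCompl_of_card_eq_one W h1).symm ▸ Nat.le_add_left _ _
    · exact (hM.balanced W h2 hlt).le
  · exact heq.symm ▸ Nat.le_add_right _ _

/-- Weighting an edge that meets the explored set at the positions `W` by `y ^ positionCost M W`,
where `y = n ^ (1 / (k - 1))`, compensates exactly for the factor `n ^ (k - |W| - rkCompl M W)`
bounding the number of such edges. -/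
theorem mul_add_positionCost (hM : IsTight M) (hk : ℓ + 1 ≤ k) (hW : W.Nonempty) :
    (k - 1) * (k - W.card - rkCompl M W) + positionCost M W = (k - 1 - ℓ) * (k - W.card) := by
  have hW1 : 1 ≤ W.card := hW.card_pos
  have hWk : W.card ≤ k := (Finset.card_le_univ W).trans_eq (Fintype.card_fin k)
  have hr : rkCompl M W ≤ k - W.card := by
    refine (Matrix.rank_le_card_width _).trans_eq ?_
    rw [Fintype.card_subtype_compl, Fintype.card_fin, Fintype.card_coe]
  rw [positionCost]
  zify [hM.le_add_mul_rkCompl hW, hW1, hWk, hr, (by omega : 1 ≤ k), (by omega : ℓ ≤ k - 1)]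
  ring

end IsTight

theorem StrictlyBalanced.isTight (hk : ℓ + 2 ≤ k) (hM : StrictlyBalanced M) (hstar : RowStar M)
    (hirr : (LinearSystem.homogeneous M).Irredundant) : IsTight M := by
  obtain ⟨hrk, hbal⟩ := hM
  have hpair : ∀ W : Finset (Fin k), W.card = 2 → rkCompl M W = ℓ := by
    intro W hW
    obtain ⟨i, j, hij, rfl⟩ := Finset.card_eq_two.1 hW
    rw [rkCompl_pair hstar hirr hij, hrk]
  refine ⟨fun W hW => ?_, hpair, fun W hW2 hWk => ?_⟩
  · obtain ⟨W', hWW', hW'⟩ := Finset.exists_superset_card_eq (s := W) (n := 2) (by omega)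
      (by rw [Fintype.card_fin]; omega)
    refine le_antisymm ((rkCompl_le_rk M W).trans_eq hrk) ?_
    exact (hpair W' hW').ge.trans (rkCompl_anti M hWW')
  · have hdrop : (ℓ : ℝ) + 2 ≤ W.card + rkCompl M W := by
      have := rk_add_two_le hstar hirr hW2
      rw [hrk] at this
      exact_mod_cast this
    have hkR : (ℓ : ℝ) + 2 ≤ k := by exact_mod_cast hk
    have hlt := hbal W hW2 hWk
    rw [div_lt_div_iff₀ (by linarith) (by linarith)] at hlt
    suffices ((k - 1 : ℕ) : ℝ) * ℓ < ((W.card - 1 : ℕ) : ℝ) * ℓ + ((k - 1 : ℕ) : ℝ) * rkCompl M W by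
      exact_mod_cast this
    rw [Nat.cast_pred (by omega), Nat.cast_pred (by omega)]
    linarith

theorem StrictlyBalanced.m_eq (hk : 2 ≤ k) (hM : StrictlyBalanced M) :
    m M = ((k : ℝ) - 1) / ((k : ℝ) - 1 - ℓ) := by
  obtain ⟨hrk, hbal⟩ := hM
  have hcard : (Finset.univ : Finset (Fin k)).card = k := Finset.card_fin k
  have huniv : 2 ≤ (Finset.univ : Finset (Fin k)).card := hcard.ge.trans' hk
  have : Nonempty {W : Finset (Fin k) // 2 ≤ W.card} := ⟨⟨_, huniv⟩⟩
  rw [m, hrk]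
  refine le_antisymm (ciSup_le fun ⟨W, hW⟩ => ?_) ?_
  · rcases (Finset.card_le_univ W).lt_or_eq with hlt | heq
    · rw [Fintype.card_fin] at hlt
      exact (hbal W hW hlt).le
    · obtain rfl := (Finset.card_eq_iff_eq_univ W).1 heq
      simp [rkCompl_univ]
  · refine le_trans (le_of_eq ?_) (le_ciSup (Set.finite_range _).bddAbove ⟨_, huniv⟩)
    simp [rkCompl_univ]

theorem mPair_eq_of_m_eq {N : Matrix (Fin ℓ') (Fin k') ℤ} (hk : 2 ≤ k) (hstar : RowStar M)
    (hirr : (LinearSystem.homogeneous M).Irredundant) {a : ℝ} (ha : 0 < a) (hM : m M = a)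
    (hN : m N = a) : mPair M N = a := by
  let denom (W : {W : Finset (Fin k) // 2 ≤ W.card}) : ℝ := W.1.card - 1 + rkCompl M W.1 - rk M
  have hdenom : ∀ W, 0 < denom W := fun W => by
    have : (rk M : ℝ) + 2 ≤ W.1.card + rkCompl M W.1 := by
      exact_mod_cast rk_add_two_le hstar hirr W.2
    simp only [denom]
    linarith
  have hdenom' : ∀ W, 0 < denom W + 1 / a := fun W => add_pos (hdenom W) (by positivity)
  have : Nonempty {W : Finset (Fin k) // 2 ≤ W.card} :=
    ⟨⟨Finset.univ, hk.trans_eq (Finset.card_fin k).symm⟩⟩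
  have hsup : ⨆ W, ((W.1.card : ℝ) - 1) / denom W = a := hM
  rw [mPair, hN]
  change ⨆ W, (W.1.card : ℝ) / (denom W + 1 / a) = a
  refine le_antisymm (ciSup_le fun W => ?_) ?_
  · have hle := le_ciSup (f := fun W => ((W.1.card : ℝ) - 1) / denom W)
      (Set.finite_range _).bddAbove W
    rw [hsup, div_le_iff₀ (hdenom W)] at hle
    rw [div_le_iff₀ (hdenom' W), mul_add, mul_one_div_cancel ha.ne']
    linarith
  · obtain ⟨W, hW⟩ := exists_eq_ciSup_of_finite (f := fun W => ((W.1.card : ℝ) - 1) / denom W)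
    rw [hsup, div_eq_iff (hdenom W).ne'] at hW
    refine le_trans (le_of_eq ?_) (le_ciSup (Set.finite_range _).bddAbove W)
    rw [eq_div_iff (hdenom' W).ne', mul_add, mul_one_div_cancel ha.ne']
    linarith

end Integer

end RadoMatrix

namespace RadoHypergraph

open RadoMatrix

section Solutions

variable {κ : Type*} {k ℓ n : ℕ} {e : κ × (Fin k → ℕ)} {X : Finset ℕ}

/-- The set of entries of a coloured tuple; coloured tuples are the edges of the hypergraph of
solutions. -/
def vert (e : κ × (Fin k → ℕ)) : Finset ℕ := Finset.univ.image e.2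

/-- The positions at which the entries of `e` lie in `X`. -/
def positions (e : κ × (Fin k → ℕ)) (X : Finset ℕ) : Finset (Fin k) :=
  Finset.univ.filter fun j => e.2 j ∈ X

/-- The cost of adding the edge `e` to an exploration that has reached the vertex set `X`. -/
noncomputable def edgeCost (C : κ → Matrix (Fin ℓ) (Fin k) ℤ) (e : κ × (Fin k → ℕ))
    (X : Finset ℕ) : ℕ := positionCost (C e.1) (positions e X)

theorem mem_vert {v : ℕ} : v ∈ vert e ↔ ∃ j, e.2 j = v := by
  simp [vert]

theorem mem_positions {j : Fin k} : j ∈ positions e X ↔ e.2 j ∈ X := by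
  simp [positions]

theorem positions_vert_inter (e : κ × (Fin k → ℕ)) (X : Finset ℕ) :
    positions e (vert e ∩ X) = positions e X := by
  ext j
  simp [mem_positions, mem_vert]

theorem card_vert (he : Function.Injective e.2) : (vert e).card = k := by
  rw [vert, Finset.card_image_of_injective _ he, Finset.card_fin]

theorem card_positions (he : Function.Injective e.2) (X : Finset ℕ) :
    (positions e X).card = (vert e ∩ X).card := by
  have himage : (positions e X).image e.2 = vert e ∩ X := by
    ext v
    simp only [Finset.mem_image, mem_positions, Finset.mem_inter, mem_vert]
    exact ⟨fun ⟨j, hj, hv⟩ => ⟨⟨j, hv⟩, hv ▸ hj⟩, fun ⟨⟨j, hv⟩, hX⟩ => ⟨j, hv ▸ hX, hv⟩⟩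
  rw [← himage, Finset.card_image_of_injective _ he]

theorem card_union_vert (he : Function.Injective e.2) (X : Finset ℕ) :
    (X ∪ vert e).card = X.card + (k - (positions e X).card) := by
  have hsdiff := Finset.card_sdiff_add_card_inter (vert e) X
  rw [card_vert he] at hsdiff
  rw [← Finset.union_sdiff_self_eq_union, Finset.card_union_of_disjoint Finset.disjoint_sdiff,
    card_positions he]
  omega

variable [Fintype κ] {C : κ → Matrix (Fin ℓ) (Fin k) ℤ} {b : κ → Fin ℓ → ℚ}

open Classical in
/-- The solutions in `{1, …, n}` with distinct entries of the systems `C τ x = b τ`, coloured by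
`τ`. -/
noncomputable def solutions (C : κ → Matrix (Fin ℓ) (Fin k) ℤ) (b : κ → Fin ℓ → ℚ) (n : ℕ) :
    Finset (κ × (Fin k → ℕ)) :=
  (Finset.univ ×ˢ Fintype.piFinset fun _ => Finset.Icc 1 n).filter fun e =>
    Function.Injective e.2 ∧ (toRat (C e.1)).mulVec (fun i => (e.2 i : ℚ)) = b e.1

theorem mem_solutions : e ∈ solutions C b n ↔
    (∀ i, e.2 i ∈ Finset.Icc 1 n) ∧ Function.Injective e.2 ∧
      (toRat (C e.1)).mulVec (fun i => (e.2 i : ℚ)) = b e.1 := by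
  simp [solutions]

theorem injective_of_mem_solutions (he : e ∈ solutions C b n) : Function.Injective e.2 :=
  (mem_solutions.1 he).2.1

theorem card_le_of_mem_positions {τ : κ} {J : Finset (Fin k)} {Y : Finset ℕ}
    {s : Finset (κ × (Fin k → ℕ))} (hs : s ⊆ solutions C b n) (hτ : ∀ e ∈ s, e.1 = τ)
    (hJ : ∀ e ∈ s, ∀ j ∈ J, e.2 j ∈ Y) :
    s.card ≤ Y.card ^ J.card * n ^ (k - J.card - rkCompl (C τ) J) := by
  classical
  have hinj : Set.InjOn Prod.snd (s : Set (κ × (Fin k → ℕ))) := fun e he e' he' hee' =>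
    Prod.ext ((hτ e he).trans (hτ e' he').symm) hee'
  have hb : ∀ e ∈ s, (toRat (C τ)).mulVec (Nat.cast ∘ e.2) = b τ := fun e he =>
    hτ e he ▸ (mem_solutions.1 (hs he)).2.2
  have hcard := card_solutions_mem_le (M := toRat (C τ)) (Nat.cast_injective (R := ℚ))
    (s := s.image Prod.snd) (A := Finset.Icc 1 n) (J := J) (Y := Y)
    (Finset.forall_mem_image.2 fun e he => (mem_solutions.1 (hs he)).1)
    (Finset.forall_mem_image.2 fun e he => Finset.forall_mem_image.2 fun e' he' =>
      (hb e he).trans (hb e' he').symm)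
    (Finset.forall_mem_image.2 hJ)
  rwa [Finset.card_image_of_injOn hinj, Nat.card_Icc, Nat.add_sub_cancel, Fintype.card_fin] at hcard

end Solutions

section Weights

variable {κ : Type*} [Fintype κ] {k ℓ n : ℕ} {C : κ → Matrix (Fin ℓ) (Fin k) ℤ}
  {b : κ → Fin ℓ → ℚ} {p y c : ℝ}

/-- The relation between the probability `p`, the scale `y = n ^ (1 / (k - 1))` and a small constant
`c` that makes the first-moment argument work: `p` is at most `c * n ^ (-(k - 1 - ℓ) / (k - 1))`,
and appending an edge to a path multiplies the expected number of paths by at most `exp (-1)`. -/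
structure IsScale (κ : Type*) [Fintype κ] (k ℓ n : ℕ) (p y c : ℝ) : Prop where
  nonneg : 0 ≤ p
  one_le : 1 ≤ y
  pow_eq : y ^ (k - 1) = n
  mul_le : p * y ^ (k - 1 - ℓ) ≤ c
  le_one : c ≤ 1
  ratio_le : Fintype.card κ * (k * (k * c ^ (k - 1))) ≤ Real.exp (-1)

theorem IsScale.const_nonneg (h : IsScale κ k ℓ n p y c) : 0 ≤ c :=
  le_trans (mul_nonneg h.nonneg (pow_nonneg (zero_le_one.trans h.one_le) _)) h.mul_le

/-- The factor by which adding the edge `e` to an exploration that has reached the vertex set `X`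
multiplies its weight. -/
noncomputable def edgeWeight (C : κ → Matrix (Fin ℓ) (Fin k) ℤ) (p y : ℝ) (X : Finset ℕ)
    (e : κ × (Fin k → ℕ)) : ℝ :=
  p ^ (k - (positions e X).card) * y ^ edgeCost C e X

theorem sum_edgeWeight_of_positions_eq_le (hk : ℓ + 1 ≤ k) (h : IsScale κ k ℓ n p y c) {τ : κ}
    (hC : IsTight (C τ)) {J : Finset (Fin k)} (hJ : J.Nonempty) {X Y : Finset ℕ}
    {s : Finset (κ × (Fin k → ℕ))} (hs : s ⊆ solutions C b n) (hτ : ∀ e ∈ s, e.1 = τ)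
    (hX : ∀ e ∈ s, positions e X = J) (hY : ∀ e ∈ s, ∀ j ∈ J, e.2 j ∈ Y) :
    ∑ e ∈ s, edgeWeight C p y X e ≤ Y.card ^ J.card * c ^ (k - J.card) := by
  have hp := h.nonneg
  have hy : 0 ≤ y := zero_le_one.trans h.one_le
  have hcard : (s.card : ℝ) ≤ Y.card ^ J.card * (n : ℝ) ^ (k - J.card - rkCompl (C τ) J) := by
    exact_mod_cast card_le_of_mem_positions hs hτ hY
  calc ∑ e ∈ s, edgeWeight C p y X e
      = s.card * (p ^ (k - J.card) * y ^ positionCost (C τ) J) := by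
        rw [← nsmul_eq_mul, ← Finset.sum_const]
        exact Finset.sum_congr rfl fun e he => by rw [edgeWeight, edgeCost, hX e he, hτ e he]
    _ ≤ Y.card ^ J.card * (n : ℝ) ^ (k - J.card - rkCompl (C τ) J) *
          (p ^ (k - J.card) * y ^ positionCost (C τ) J) := by gcongr
    _ = Y.card ^ J.card * (p * y ^ (k - 1 - ℓ)) ^ (k - J.card) := by
        rw [← h.pow_eq, mul_pow, ← pow_mul, ← pow_mul, ← hC.mul_add_positionCost hk hJ, pow_add]
        ring
    _ ≤ Y.card ^ J.card * c ^ (k - J.card) := by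
        gcongr
        exact h.mul_le

theorem sum_edgeWeight_le (hk : ℓ + 1 ≤ k) (h : IsScale κ k ℓ n p y c) (hC : ∀ τ, IsTight (C τ))
    {X Y : Finset ℕ} {Q : Finset (Finset (Fin k))} (hQ : ∀ J ∈ Q, J.Nonempty)
    {s : Finset (κ × (Fin k → ℕ))} (hs : s ⊆ solutions C b n) (hsQ : ∀ e ∈ s, positions e X ∈ Q)
    (hY : ∀ e ∈ s, ∀ j ∈ positions e X, e.2 j ∈ Y) :
    ∑ e ∈ s, edgeWeight C p y X e ≤
      Fintype.card κ * ∑ J ∈ Q, (Y.card : ℝ) ^ J.card * c ^ (k - J.card) := by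
  classical
  have hmaps : ∀ e ∈ s, (e.1, positions e X) ∈ Finset.univ ×ˢ Q := fun e he =>
    Finset.mem_product.2 ⟨Finset.mem_univ _, hsQ e he⟩
  calc ∑ e ∈ s, edgeWeight C p y X e
      = ∑ i ∈ Finset.univ ×ˢ Q, ∑ e ∈ s with (e.1, positions e X) = i, edgeWeight C p y X e :=
        (Finset.sum_fiberwise_of_maps_to hmaps _).symm
    _ ≤ ∑ i ∈ (Finset.univ : Finset κ) ×ˢ Q, (Y.card : ℝ) ^ i.2.card * c ^ (k - i.2.card) := by
        refine Finset.sum_le_sum fun ⟨τ, J⟩ hi => ?_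
        have hfibre : ∀ e ∈ s.filter fun e => (e.1, positions e X) = (τ, J),
            e ∈ s ∧ e.1 = τ ∧ positions e X = J := fun e he => by simpa using he
        refine sum_edgeWeight_of_positions_eq_le hk h (hC τ) (hQ J (Finset.mem_product.1 hi).2)
          ((Finset.filter_subset _ _).trans hs) (fun e he => (hfibre e he).2.1)
          (fun e he => (hfibre e he).2.2) fun e he j hj => ?_
        obtain ⟨hes, -, rfl⟩ := hfibre e he
        exact hY e hes j hj
    _ = Fintype.card κ * ∑ J ∈ Q, (Y.card : ℝ) ^ J.card * c ^ (k - J.card) := by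
        rw [Finset.sum_product]
        simp only [Finset.sum_const, Finset.card_univ, nsmul_eq_mul]

theorem sum_edgeWeight_of_card_eq_one_le (hk : ℓ + 1 ≤ k) (h : IsScale κ k ℓ n p y c)
    (hC : ∀ τ, IsTight (C τ)) {X Y : Finset ℕ} (hYX : Y ⊆ X) (hYk : Y.card = k)
    {s : Finset (κ × (Fin k → ℕ))} (hs : s ⊆ solutions C b n)
    (hX : ∀ e ∈ s, (vert e ∩ X).card = 1) (hY : ∀ e ∈ s, (vert e ∩ Y).Nonempty) :
    ∑ e ∈ s, edgeWeight C p y X e ≤ Real.exp (-1) := by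
  refine (sum_edgeWeight_le hk h hC (Y := Y) (Q := Finset.univ.map ⟨_, Finset.singleton_injective⟩)
    ?_ hs ?_ ?_).trans (le_trans (le_of_eq ?_) h.ratio_le)
  · simp
  · intro e he
    rw [Finset.mem_map]
    obtain ⟨j, hj⟩ := Finset.card_eq_one.1
      ((card_positions (injective_of_mem_solutions (hs he)) X).trans (hX e he))
    exact ⟨j, Finset.mem_univ j, hj.symm⟩
  · intro e he j hj
    have hsub : vert e ∩ Y ⊆ vert e ∩ X := Finset.inter_subset_inter_left hYX
    have heq := Finset.eq_of_subset_of_card_le hsub ((hX e he).trans_le (hY e he).card_pos)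
    have hmem : e.2 j ∈ vert e ∩ X :=
      Finset.mem_inter.2 ⟨mem_vert.2 ⟨j, rfl⟩, mem_positions.1 hj⟩
    exact (Finset.mem_inter.1 (heq ▸ hmem)).2
  · simp [hYk]

theorem sum_edgeWeight_of_nonempty_le (hk : ℓ + 1 ≤ k) (h : IsScale κ k ℓ n p y c)
    (hC : ∀ τ, IsTight (C τ)) {N : ℕ} {X : Finset ℕ} (hX : X.card ≤ N) (hN : 1 ≤ N)
    {s : Finset (κ × (Fin k → ℕ))} (hs : s ⊆ solutions C b n)
    (hsX : ∀ e ∈ s, (vert e ∩ X).Nonempty) :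
    ∑ e ∈ s, edgeWeight C p y X e ≤ Fintype.card κ * (2 ^ k * N ^ k) := by
  refine (sum_edgeWeight_le hk h hC (Y := X) (Q := Finset.univ.filter Finset.Nonempty)
    (fun J hJ => (Finset.mem_filter.1 hJ).2) hs (fun e he => ?_)
    (fun e _ j hj => mem_positions.1 hj)).trans ?_
  · rw [Finset.mem_filter, ← Finset.card_pos, card_positions (injective_of_mem_solutions (hs he))]
    exact ⟨Finset.mem_univ _, (hsX e he).card_pos⟩
  have hc := h.const_nonneg
  have hterm : ∀ J : Finset (Fin k), (X.card : ℝ) ^ J.card * c ^ (k - J.card) ≤ N ^ k := fun J =>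
    calc (X.card : ℝ) ^ J.card * c ^ (k - J.card) ≤ (N : ℝ) ^ J.card * 1 := by
          gcongr
          exact pow_le_one₀ hc h.le_one
      _ ≤ N ^ k := by
          rw [mul_one]
          exact pow_le_pow_right₀ (by exact_mod_cast hN) (by simpa using Finset.card_le_univ J)
  refine mul_le_mul_of_nonneg_left ?_ (Nat.cast_nonneg _)
  calc ∑ J ∈ Finset.univ.filter Finset.Nonempty, (X.card : ℝ) ^ J.card * c ^ (k - J.card)
      ≤ ∑ J : Finset (Fin k), (X.card : ℝ) ^ J.card * c ^ (k - J.card) :=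
        Finset.sum_le_sum_of_subset_of_nonneg (Finset.filter_subset _ _) fun J _ _ => by positivity
    _ ≤ ∑ _J : Finset (Fin k), (N : ℝ) ^ k := Finset.sum_le_sum fun J _ => hterm J
    _ = 2 ^ k * N ^ k := by simp

theorem sum_solutions_le (hk : ℓ + 1 ≤ k) (h : IsScale κ k ℓ n p y c) (hC : ∀ τ, IsTight (C τ)) :
    ∑ _e ∈ solutions C b n, p ^ k ≤ Fintype.card κ * y ^ ℓ := by
  classical
  have hp := h.nonneg
  have hy : 0 ≤ y := zero_le_one.trans h.one_le
  have hexp : (k - 1) * (k - ℓ) = ℓ + (k - 1 - ℓ) * k := by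
    zify [(by omega : 1 ≤ k), (by omega : ℓ ≤ k), (by omega : ℓ ≤ k - 1)]
    ring
  have hcolour : ∀ τ, ∑ _e ∈ (solutions C b n).filter (fun e => e.1 = τ), p ^ k ≤ y ^ ℓ := by
    intro τ
    have hcard : (((solutions C b n).filter fun e => e.1 = τ).card : ℝ) ≤ (n : ℝ) ^ (k - ℓ) := by
      have := card_le_of_mem_positions (τ := τ) (J := ∅) (Y := ∅)
        (Finset.filter_subset (fun e => e.1 = τ) (solutions C b n))
        (fun e he => (Finset.mem_filter.1 he).2) (by simp)
      simp only [(hC τ).rkCompl_empty (by omega), Finset.card_empty, pow_zero, one_mul,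
        Nat.sub_zero] at this
      exact_mod_cast this
    rw [Finset.sum_const, nsmul_eq_mul]
    calc _ ≤ (n : ℝ) ^ (k - ℓ) * p ^ k := by gcongr
      _ = y ^ ℓ * (p * y ^ (k - 1 - ℓ)) ^ k := by
        rw [← h.pow_eq, mul_pow, ← pow_mul, ← pow_mul, hexp, pow_add]
        ring
      _ ≤ y ^ ℓ := mul_le_of_le_one_right (by positivity)
        (pow_le_one₀ (by positivity) (h.mul_le.trans h.le_one))
  rw [← Finset.sum_fiberwise (solutions C b n) Prod.fst, ← nsmul_eq_mul, ← Finset.card_univ,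
    ← Finset.sum_const]
  exact Finset.sum_le_sum fun τ _ => hcolour τ

end Weights

end RadoHypergraph

namespace RadoHypergraph

open RadoMatrix

section States

/-- What is recorded of an exploration of the hypergraph of solutions: its cost, the explored
vertex set and the last edge. -/
structure State (κ : Type*) (k : ℕ) where
  cost : ℕ
  explored : Finset ℕ
  last : κ × (Fin k → ℕ)

noncomputable instance (κ : Type*) (k : ℕ) : DecidableEq (State κ k) := Classical.decEq _

variable {κ : Type*} {k ℓ n s r : ℕ} {C : κ → Matrix (Fin ℓ) (Fin k) ℤ} {b : κ → Fin ℓ → ℚ}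
  {p y c : ℝ}

namespace State

/-- The state after the edge `e` has been added. -/
noncomputable def attach (C : κ → Matrix (Fin ℓ) (Fin k) ℤ) (t : State κ k)
    (e : κ × (Fin k → ℕ)) : State κ k :=
  ⟨t.cost + edgeCost C e t.explored, t.explored ∪ vert e, e⟩

/-- The edge `e` may be added by a step that is not free. -/
def IsExt (t : State κ k) (e : κ × (Fin k → ℕ)) : Prop :=
  (vert e ∩ t.explored).card = 1 ∧ (vert e ∩ vert t.last).Nonempty

/-- The edge `e` may be added by a free step. -/
def IsFree (t : State κ k) (e : κ × (Fin k → ℕ)) : Prop := (vert e ∩ t.explored).Nonempty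

/-- The weight of a state. The number of vertices accounts for the probability that the explored
set survives, the cost for the number of solutions lost to the constraints already imposed. -/
noncomputable def weight (p y : ℝ) (t : State κ k) : ℝ := p ^ t.explored.card * y ^ t.cost

theorem weight_nonneg (hp : 0 ≤ p) (hy : 0 ≤ y) (t : State κ k) : 0 ≤ t.weight p y :=
  mul_nonneg (pow_nonneg hp _) (pow_nonneg hy _)

theorem weight_attach {e : κ × (Fin k → ℕ)} (he : Function.Injective e.2) (t : State κ k) :
    (t.attach C e).weight p y = t.weight p y * edgeWeight C p y t.explored e := by
  rw [weight, weight, edgeWeight, attach, card_union_vert he, pow_add, pow_add]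
  ring

end State

variable [Fintype κ]

open Classical in
/-- The states obtained from those in `Z` by adding a solution that is related to the state
by `P`. -/
noncomputable def attachAll (C : κ → Matrix (Fin ℓ) (Fin k) ℤ) (b : κ → Fin ℓ → ℚ) (n : ℕ)
    (P : State κ k → κ × (Fin k → ℕ) → Prop) (Z : Finset (State κ k)) : Finset (State κ k) :=
  (Z.sigma fun t => (solutions C b n).filter (P t)).image fun a => a.1.attach C a.2

/-- The states of the explorations with `s + 1` edges, `r` of them added freely. -/
noncomputable def states (C : κ → Matrix (Fin ℓ) (Fin k) ℤ) (b : κ → Fin ℓ → ℚ) (n : ℕ) :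
    ℕ → ℕ → Finset (State κ k)
  | 0, 0 => (solutions C b n).image fun e => ⟨0, vert e, e⟩
  | 0, _ + 1 => ∅
  | s + 1, 0 => attachAll C b n State.IsExt (states C b n s 0)
  | s + 1, r + 1 => attachAll C b n State.IsExt (states C b n s (r + 1)) ∪
      attachAll C b n State.IsFree (states C b n s r)

theorem mem_attachAll {P : State κ k → κ × (Fin k → ℕ) → Prop} {Z : Finset (State κ k)}
    {t : State κ k} : t ∈ attachAll C b n P Z ↔
      ∃ t' ∈ Z, ∃ e ∈ solutions C b n, P t' e ∧ t'.attach C e = t := by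
  simp [attachAll, and_assoc]

theorem attachAll_isExt_subset_states (s r : ℕ) :
    attachAll C b n State.IsExt (states C b n s r) ⊆ states C b n (s + 1) r := by
  cases r with
  | zero => rw [states]
  | succ r =>
    rw [states]
    exact Finset.subset_union_left

theorem attachAll_isFree_subset_states (s r : ℕ) :
    attachAll C b n State.IsFree (states C b n s r) ⊆ states C b n (s + 1) (r + 1) := by
  rw [states]
  exact Finset.subset_union_right

theorem Exploration.mem_states (hC : ∀ τ, IsTight (C τ)) {q : ℕ} {X : Finset ℕ}
    {e : κ × (Fin k → ℕ)}
    (h : Exploration vert (edgeCost C) (solutions C b n : Set (κ × (Fin k → ℕ))) s r q X e) :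
    ∃ s', s = s' + 1 ∧ ⟨q, X, e⟩ ∈ states C b n s' r := by
  induction h with
  | start e he =>
    exact ⟨0, rfl, by rw [states]; exact Finset.mem_image.2 ⟨e, he, rfl⟩⟩
  | @ext s r q X e _ e' he' hcard hlast ih =>
    obtain ⟨s', rfl, hmem⟩ := ih
    have hcost : edgeCost C e' X = 0 := (hC e'.1).positionCost_of_card_eq_one
      ((card_positions (injective_of_mem_solutions he') X).trans hcard)
    refine ⟨s' + 1, rfl, attachAll_isExt_subset_states _ _ (mem_attachAll.2
      ⟨_, hmem, e', he', ⟨hcard, hlast⟩, ?_⟩)⟩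
    rw [State.attach, hcost, add_zero]
  | @free s r q X e _ e' he' hmeet ih =>
    obtain ⟨s', rfl, hmem⟩ := ih
    refine ⟨s' + 1, rfl, attachAll_isFree_subset_states _ _ (mem_attachAll.2
      ⟨_, hmem, e', he', hmeet, ?_⟩)⟩
    rw [State.attach, edgeCost, edgeCost, positions_vert_inter]

theorem states_induction {P : ℕ → State κ k → Prop}
    (hstart : ∀ e ∈ solutions C b n, P 0 ⟨0, vert e, e⟩)
    (hattach : ∀ s t, P s t → ∀ e ∈ solutions C b n, P (s + 1) (t.attach C e))
    {t : State κ k} (ht : t ∈ states C b n s r) : P s t := by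
  induction s generalizing r t with
  | zero =>
    cases r with
    | zero =>
      rw [states] at ht
      obtain ⟨e, he, rfl⟩ := Finset.mem_image.1 ht
      exact hstart e he
    | succ r => simp [states] at ht
  | succ s ih =>
    have step : ∀ (r : ℕ) (Q : State κ k → κ × (Fin k → ℕ) → Prop),
        t ∈ attachAll C b n Q (states C b n s r) → P (s + 1) t := by
      intro r Q ht
      obtain ⟨t', ht', e, he, -, rfl⟩ := mem_attachAll.1 ht
      exact hattach s t' (ih ht') e he
    cases r with
    | zero => exact step _ _ (by rwa [states] at ht)
    | succ r =>
      rw [states] at ht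
      exact (Finset.mem_union.1 ht).elim (step _ _) (step _ _)

theorem last_mem_solutions {t : State κ k} (ht : t ∈ states C b n s r) :
    t.last ∈ solutions C b n :=
  states_induction (P := fun _ t => t.last ∈ solutions C b n) (fun _ he => he)
    (fun _ _ _ _ he => he) ht

theorem vert_last_subset_explored {t : State κ k} (ht : t ∈ states C b n s r) :
    vert t.last ⊆ t.explored :=
  states_induction (P := fun _ t => vert t.last ⊆ t.explored)
    (fun _ _ => Finset.Subset.refl _) (fun _ _ _ _ _ => Finset.subset_union_right) ht

theorem card_explored_le {t : State κ k} (ht : t ∈ states C b n s r) :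
    t.explored.card ≤ k * (s + 1) := by
  refine states_induction (P := fun s t => t.explored.card ≤ k * (s + 1)) (fun e he => ?_)
    (fun s t hle e he => ?_) ht
  · simp [card_vert (injective_of_mem_solutions he)]
  · refine (Finset.card_union_le _ _).trans ?_
    rw [card_vert (injective_of_mem_solutions he), mul_add_one k (s + 1)]
    exact Nat.add_le_add_right hle k

theorem sum_weight_attachAll_le (hp : 0 ≤ p) (hy : 0 ≤ y)
    {P : State κ k → κ × (Fin k → ℕ) → Prop} {Z : Finset (State κ k)} {B : ℝ}
    (hB : ∀ t ∈ Z, ∀ s ⊆ solutions C b n, (∀ e ∈ s, P t e) →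
      ∑ e ∈ s, edgeWeight C p y t.explored e ≤ B) :
    ∑ t ∈ attachAll C b n P Z, t.weight p y ≤ B * ∑ t ∈ Z, t.weight p y := by
  classical
  refine (Finset.sum_image_le_of_nonneg fun t _ => t.weight_nonneg hp hy).trans ?_
  rw [Finset.sum_sigma, Finset.mul_sum]
  refine Finset.sum_le_sum fun t ht => ?_
  calc ∑ e ∈ (solutions C b n).filter (P t), (t.attach C e).weight p y
      = (∑ e ∈ (solutions C b n).filter (P t), edgeWeight C p y t.explored e) * t.weight p y := by
        rw [Finset.sum_mul]
        refine Finset.sum_congr rfl fun e he => ?_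
        rw [State.weight_attach (injective_of_mem_solutions (Finset.mem_filter.1 he).1), mul_comm]
    _ ≤ B * t.weight p y :=
        mul_le_mul_of_nonneg_right (hB t ht _ (Finset.filter_subset _ _)
          fun e he => (Finset.mem_filter.1 he).2) (t.weight_nonneg hp hy)

theorem sum_weight_attachAll_isExt_le (hk : ℓ + 1 ≤ k) (h : IsScale κ k ℓ n p y c)
    (hC : ∀ τ, IsTight (C τ)) (s r : ℕ) :
    ∑ t ∈ attachAll C b n State.IsExt (states C b n s r), t.weight p y ≤
      Real.exp (-1) * ∑ t ∈ states C b n s r, t.weight p y :=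
  sum_weight_attachAll_le h.nonneg (zero_le_one.trans h.one_le) fun _ ht _ hs hP =>
    sum_edgeWeight_of_card_eq_one_le hk h hC (vert_last_subset_explored ht)
      (card_vert (injective_of_mem_solutions (last_mem_solutions ht))) hs
      (fun e he => (hP e he).1) fun e he => (hP e he).2

theorem sum_weight_attachAll_isFree_le (hk : ℓ + 1 ≤ k) (h : IsScale κ k ℓ n p y c)
    (hC : ∀ τ, IsTight (C τ)) {N : ℕ} (hsN : k * (s + 1) ≤ N) (r : ℕ) :
    ∑ t ∈ attachAll C b n State.IsFree (states C b n s r), t.weight p y ≤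
      Fintype.card κ * (2 ^ k * N ^ k) * ∑ t ∈ states C b n s r, t.weight p y :=
  sum_weight_attachAll_le h.nonneg (zero_le_one.trans h.one_le) fun _ ht _ hs hP =>
    sum_edgeWeight_of_nonempty_le hk h hC ((card_explored_le ht).trans hsN)
      ((Nat.mul_pos (by omega) s.succ_pos).trans_le hsN) hs hP

theorem sum_weight_states_zero_zero_le (hk : ℓ + 1 ≤ k) (h : IsScale κ k ℓ n p y c)
    (hC : ∀ τ, IsTight (C τ)) :
    ∑ t ∈ states C b n 0 0, t.weight p y ≤ Fintype.card κ * y ^ ℓ := by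
  rw [states]
  refine (Finset.sum_image_le_of_nonneg fun t _ =>
    t.weight_nonneg h.nonneg (zero_le_one.trans h.one_le)).trans
    ((Finset.sum_congr rfl fun e he => ?_).trans_le (sum_solutions_le (b := b) hk h hC))
  simp [State.weight, card_vert (injective_of_mem_solutions he)]

theorem sum_weight_states_zero_le (hk : ℓ + 1 ≤ k) (h : IsScale κ k ℓ n p y c)
    (hC : ∀ τ, IsTight (C τ)) (s : ℕ) :
    ∑ t ∈ states C b n s 0, t.weight p y ≤ Fintype.card κ * y ^ ℓ * Real.exp (-1) ^ s := by
  induction s with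
  | zero => simpa using sum_weight_states_zero_zero_le hk h hC
  | succ s ih =>
    rw [states]
    calc _ ≤ Real.exp (-1) * ∑ t ∈ states C b n s 0, t.weight p y :=
          sum_weight_attachAll_isExt_le hk h hC s 0
      _ ≤ Real.exp (-1) * (Fintype.card κ * y ^ ℓ * Real.exp (-1) ^ s) := by gcongr
      _ = Fintype.card κ * y ^ ℓ * Real.exp (-1) ^ (s + 1) := by ring

theorem sum_weight_states_succ_succ_le (hk : ℓ + 1 ≤ k) (h : IsScale κ k ℓ n p y c)
    (hC : ∀ τ, IsTight (C τ)) {N : ℕ} (hsN : k * (s + 1) ≤ N) (r : ℕ) :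
    ∑ t ∈ states C b n (s + 1) (r + 1), t.weight p y ≤
      ∑ t ∈ states C b n s (r + 1), t.weight p y +
        Fintype.card κ * (2 ^ k * N ^ k) * ∑ t ∈ states C b n s r, t.weight p y := by
  have hnonneg : ∀ Z : Finset (State κ k), 0 ≤ ∑ t ∈ Z, t.weight p y := fun Z =>
    Finset.sum_nonneg fun t _ => t.weight_nonneg h.nonneg (zero_le_one.trans h.one_le)
  have hexp : Real.exp (-1) ≤ 1 := Real.exp_le_one_iff.2 (by norm_num)
  rw [states]
  calc _ ≤ ∑ t ∈ attachAll C b n State.IsExt (states C b n s (r + 1)), t.weight p y +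
        ∑ t ∈ attachAll C b n State.IsFree (states C b n s r), t.weight p y := by
        rw [← Finset.sum_union_inter]
        exact le_add_of_nonneg_right (hnonneg _)
    _ ≤ _ := add_le_add ((sum_weight_attachAll_isExt_le hk h hC s (r + 1)).trans
        (mul_le_of_le_one_left (hnonneg _) hexp)) (sum_weight_attachAll_isFree_le hk h hC hsN r)

theorem sum_weight_states_le (hk : ℓ + 1 ≤ k) (h : IsScale κ k ℓ n p y c)
    (hC : ∀ τ, IsTight (C τ)) {N : ℕ} (hsN : k * (s + 1) ≤ N) (r : ℕ) :
    ∑ t ∈ states C b n s r, t.weight p y ≤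
      Fintype.card κ * y ^ ℓ * ((s + 1) * (Fintype.card κ * (2 ^ k * N ^ k))) ^ r := by
  have hy : 0 ≤ y := zero_le_one.trans h.one_le
  have hsucc := fun s hsN r => 
    sum_weight_states_succ_succ_le (b := b) (s := s) (N := N) hk h hC hsN r
  have hzero := fun s => sum_weight_states_zero_le (b := b) hk h hC s
  set K : ℝ := Fintype.card κ * y ^ ℓ
  set M : ℝ := Fintype.card κ * (2 ^ k * N ^ k)
  have hK : 0 ≤ K := by positivity
  have hM : 0 ≤ M := by positivity
  have hzero_le : ∀ s, ∑ t ∈ states C b n s 0, t.weight p y ≤ K := fun s => (hzero s).trans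
    (mul_le_of_le_one_right hK (pow_le_one₀ (Real.exp_nonneg _)
      (Real.exp_le_one_iff.2 (by norm_num))))
  induction s generalizing r with
  | zero =>
    cases r with
    | zero => simpa using hzero_le 0
    | succ r => simpa [states] using by positivity
  | succ s ih =>
    have hsN' : k * (s + 1) ≤ N := le_trans (by gcongr; omega) hsN
    cases r with
    | zero => simpa using hzero_le (s + 1)
    | succ r =>
      calc _ ≤ _ := hsucc s hsN' r
        _ ≤ K * ((s + 1) * M) ^ (r + 1) + M * (K * ((s + 1) * M) ^ r) :=
            add_le_add (ih hsN' _) (mul_le_mul_of_nonneg_left (ih hsN' r) hM)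
        _ = K * (((s + 1) * M) ^ r * ((s + 1 + 1) * M)) := by ring
        _ ≤ K * (((s + 1 + 1) * M) ^ r * ((s + 1 + 1) * M)) := by
            gcongr
            linarith
        _ = K * (((s + 1 : ℕ) + 1) * M) ^ (r + 1) := by
            push_cast
            ring

end States

end RadoHypergraph

namespace RadoHypergraph

open RadoMatrix MeasureTheory ProbabilityTheory

section UnionBound

variable {ι : Type*} (u : Set ι) (p : unitInterval)

theorem setBernoulli_superset_le (X : Finset ι) :
    setBernoulli u p {S : Set ι | (X : Set ι) ⊆ S} ≤ ENNReal.ofReal ((p : ℝ) ^ X.card) := by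
  have hpre : (fun q : ι → Prop => {i | q i}) ⁻¹' {S : Set ι | (X : Set ι) ⊆ S} =
      Set.pi (X : Set ι) fun _ => {True} := by
    ext q
    simp [Set.pi, Set.subset_def]
  rw [setBernoulli_apply', hpre, Measure.infinitePi_pi _ (by measurability),
    ENNReal.ofReal_pow p.2.1, ← Finset.prod_const]
  refine Finset.prod_le_prod' fun i _ => ?_
  have hFalse : (Measure.dirac False : Measure Prop) {True} = 0 := by simp
  have hle : (Measure.dirac (i ∈ u) : Measure Prop) {True} ≤ 1 := prob_le_one
  simp only [Measure.add_apply, Measure.smul_apply, hFalse, smul_zero, add_zero]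
  calc unitInterval.toNNReal p • (Measure.dirac (i ∈ u) : Measure Prop) {True}
      ≤ (unitInterval.toNNReal p : ENNReal) * 1 := by
        rw [ENNReal.smul_def, smul_eq_mul]
        gcongr
    _ = ENNReal.ofReal p := by
        rw [mul_one, ENNReal.ofReal, Real.toNNReal_of_nonneg p.2.1]
        rfl

theorem setBernoulli_exists_superset_le {J : Type*} (Z : Finset J) (X : J → Finset ι) :
    setBernoulli u p {S : Set ι | ∃ j ∈ Z, (X j : Set ι) ⊆ S} ≤
      ENNReal.ofReal (∑ j ∈ Z, (p : ℝ) ^ (X j).card) := by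
  rw [ENNReal.ofReal_sum_of_nonneg fun j _ => pow_nonneg p.2.1 _]
  have hunion : {S : Set ι | ∃ j ∈ Z, (X j : Set ι) ⊆ S} =
      ⋃ j ∈ Z, {S : Set ι | (X j : Set ι) ⊆ S} := by
    ext S
    simp
  rw [hunion]
  exact (measure_biUnion_finset_le Z _).trans
    (Finset.sum_le_sum fun j _ => setBernoulli_superset_le u p (X j))

end UnionBound

section FirstMoment

variable {κ : Type*} [Fintype κ] {k ℓ n s r L : ℕ} {C : κ → Matrix (Fin ℓ) (Fin k) ℤ}
  {b : κ → Fin ℓ → ℚ} {y c : ℝ}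

/-- The coloured solutions in `{1, …, n}` all of whose entries lie in `S`. -/
def solutionsIn (C : κ → Matrix (Fin ℓ) (Fin k) ℤ) (b : κ → Fin ℓ → ℚ) (n : ℕ) (S : Set ℕ) :
    Set (κ × (Fin k → ℕ)) :=
  {e | e ∈ solutions C b n ∧ (vert e : Set ℕ) ⊆ S}

/-- The states in `states C b n s r` whose cost exceeds `ℓ`. -/
noncomputable def costlyStates (C : κ → Matrix (Fin ℓ) (Fin k) ℤ) (b : κ → Fin ℓ → ℚ)
    (n s r : ℕ) : Finset (State κ k) :=
  (states C b n s r).filter fun t => ℓ < t.cost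

theorem isSparse_of_states (hℓ : 0 < ℓ) (hk : 3 ≤ k) (hC : ∀ τ, IsTight (C τ)) {S : Set ℕ}
    (hcheap : ∀ s < 2 * L + 10, ∀ r < 5, ∀ t ∈ costlyStates C b n s r, ¬ (t.explored : Set ℕ) ⊆ S)
    (hshort : ∀ t ∈ states C b n L 0, ¬ (t.explored : Set ℕ) ⊆ S)
    {H : Set (κ × (Fin k → ℕ))} (hH : H ⊆ solutionsIn C b n S)
    (hprivate : ∀ e ∈ H, ∀ v ∈ vert e, ∃ e' ∈ H, vert e' ∩ vert e = {v}) :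
    IsSparse vert (edgeCost C) H k ℓ L := by
  have hHsol : H ⊆ (solutions C b n : Set (κ × (Fin k → ℕ))) := fun e he => (hH he).1
  have hHS : ∀ e ∈ H, (vert e : Set ℕ) ⊆ S := fun e he => (hH he).2
  have hpos : ∀ e ∈ H, ∀ I ⊆ vert e, (positions e I).card = I.card := fun e he I hI => by
    rw [card_positions (injective_of_mem_solutions (hHsol he)), Finset.inter_eq_right.2 hI]
  refine ⟨hk, hℓ, fun e he => card_vert (injective_of_mem_solutions (hHsol he)),
    fun e he I hI hI2 => ?_, fun e he I hI hI2 hIk => ?_, fun s r q X e hexp hs hr => ?_,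
    fun q X e hexp => ?_, hprivate⟩
  · exact ((hC e.1).positionCost_of_card_eq_two ((hpos e he I hI).trans hI2)).ge
  · rw [← hpos e he I hI] at hI2 hIk
    exact (hC e.1).positionCost_pos hI2 hIk
  · by_contra! hq
    obtain ⟨s', rfl, hmem⟩ := (hexp.mono hHsol).mem_states hC
    exact hcheap s' (by omega) r (by omega) _ (Finset.mem_filter.2 ⟨hmem, hq⟩) (hexp.subset hHS)
  · obtain ⟨s', hs', hmem⟩ := (hexp.mono hHsol).mem_states hC
    obtain rfl : s' = L := by omega
    exact hshort _ hmem (hexp.subset hHS)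

theorem exists_state_of_isUnavoidable [Nontrivial κ] (hℓ : 0 < ℓ) (hk : 3 ≤ k)
    (hC : ∀ τ, IsTight (C τ)) (L : ℕ) {S : Set ℕ}
    (hS : IsUnavoidable vert Prod.fst (solutionsIn C b n S)) :
    (∃ t ∈ states C b n L 0, (t.explored : Set ℕ) ⊆ S) ∨
      ∃ s < 2 * L + 10, ∃ r < 5, ∃ t ∈ costlyStates C b n s r, (t.explored : Set ℕ) ⊆ S := by
  by_contra! hnone
  obtain ⟨hshort, hcheap⟩ := hnone
  obtain ⟨H, hH, hmin⟩ := exists_minimal_isUnavoidable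
    ((solutions C b n).finite_toSet.subset fun e he => he.1) hS
  exact (isSparse_of_states hℓ hk hC hcheap hshort hH fun e he v hv =>
    exists_inter_eq_singleton hmin he hv).not_minimal_isUnavoidable hmin

/-- The bound on the expected number of simple paths of `L + 1` edges and of costly explorations
with at most `T = 2 * L + 10` edges, `K` being the number of colours. -/
noncomputable def expectationBound (K k ℓ L : ℕ) (y : ℝ) : ℝ :=
  K * y ^ ℓ * Real.exp (-1) ^ L +
    (2 * L + 10) * 5 * (K * ((2 * L + 10) * (K * (2 ^ k * (k * (2 * L + 10)) ^ k))) ^ 4 / y)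

variable {p : ℝ}

theorem sum_pow_card_costlyStates_le (hk : ℓ + 1 ≤ k) (h : IsScale κ k ℓ n p y c)
    (hC : ∀ τ, IsTight (C τ)) {N : ℕ} (hsN : k * (s + 1) ≤ N) (r : ℕ) :
    ∑ t ∈ costlyStates C b n s r, p ^ t.explored.card ≤
      Fintype.card κ * ((s + 1) * (Fintype.card κ * (2 ^ k * N ^ k))) ^ r / y := by
  have hp := h.nonneg
  have hy : 0 < y := zero_lt_one.trans_le h.one_le
  calc ∑ t ∈ costlyStates C b n s r, p ^ t.explored.card
      ≤ ∑ t ∈ costlyStates C b n s r, t.weight p y / y ^ (ℓ + 1) := by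
        refine Finset.sum_le_sum fun t ht => ?_
        rw [le_div_iff₀ (by positivity), State.weight]
        gcongr
        · exact h.one_le
        · exact (Finset.mem_filter.1 ht).2
    _ ≤ ∑ t ∈ states C b n s r, t.weight p y / y ^ (ℓ + 1) :=
        Finset.sum_le_sum_of_subset_of_nonneg (Finset.filter_subset _ _) fun t _ _ =>
          div_nonneg (t.weight_nonneg hp hy.le) (by positivity)
    _ ≤ Fintype.card κ * y ^ ℓ * ((s + 1) * (Fintype.card κ * (2 ^ k * N ^ k))) ^ r /
          y ^ (ℓ + 1) := by
        rw [← Finset.sum_div]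
        exact div_le_div_of_nonneg_right (sum_weight_states_le hk h hC hsN r) (by positivity)
    _ = Fintype.card κ * ((s + 1) * (Fintype.card κ * (2 ^ k * N ^ k))) ^ r / y := by
        rw [pow_succ]
        field_simp

theorem sum_pow_card_costlyStates_le_of_lt [Nonempty κ] (hk : ℓ + 1 ≤ k)
    (h : IsScale κ k ℓ n p y c) (hC : ∀ τ, IsTight (C τ)) {T : ℕ} (hs : s < T) (hr : r < 5) :
    ∑ t ∈ costlyStates C b n s r, p ^ t.explored.card ≤
      Fintype.card κ * (T * (Fintype.card κ * (2 ^ k * (k * T) ^ k))) ^ 4 / y := by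
  have hy : 0 < y := zero_lt_one.trans_le h.one_le
  have : 0 < Fintype.card κ := Fintype.card_pos
  have hpos : 0 < T * (Fintype.card κ * (2 ^ k * (k * T) ^ k)) := by
    have : 0 < k := by omega
    have : 0 < T := by omega
    positivity
  have hone : (1 : ℝ) ≤ T * (Fintype.card κ * (2 ^ k * (k * T) ^ k)) := by
    exact_mod_cast hpos
  have hsT : (s : ℝ) + 1 ≤ T := by exact_mod_cast hs
  have hle := sum_pow_card_costlyStates_le (b := b) hk h hC (Nat.mul_le_mul_left k hs) r
  rw [Nat.cast_mul] at hle
  calc _ ≤ _ := hle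
    _ ≤ Fintype.card κ * (T * (Fintype.card κ * (2 ^ k * (k * T) ^ k))) ^ r / y := by gcongr
    _ ≤ Fintype.card κ * (T * (Fintype.card κ * (2 ^ k * (k * T) ^ k))) ^ 4 / y := by
        gcongr
        omega

theorem sum_pow_card_states_add_sum_costlyStates_le [Nonempty κ] (hk : ℓ + 1 ≤ k)
    (h : IsScale κ k ℓ n p y c) (hC : ∀ τ, IsTight (C τ)) (L : ℕ) :
    ∑ t ∈ states C b n L 0, p ^ t.explored.card +
      ∑ i ∈ Finset.range (2 * L + 10) ×ˢ Finset.range 5,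
        ∑ t ∈ costlyStates C b n i.1 i.2, p ^ t.explored.card ≤
      expectationBound (Fintype.card κ) k ℓ L y := by
  have hp := h.nonneg
  refine add_le_add ((Finset.sum_le_sum fun t _ => ?_).trans
    (sum_weight_states_zero_le hk h hC L)) ((Finset.sum_le_card_nsmul _ _ _ fun i hi => ?_).trans_eq
      (?_ : _ • ((Fintype.card κ : ℝ) * (((2 * L + 10 : ℕ) : ℝ) *
        (Fintype.card κ * (2 ^ k * (k * ((2 * L + 10 : ℕ) : ℝ)) ^ k))) ^ 4 / y) = _))
  · exact le_mul_of_one_le_right (by positivity) (one_le_pow₀ h.one_le)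
  · obtain ⟨hs, hr⟩ := Finset.mem_product.1 hi
    exact sum_pow_card_costlyStates_le_of_lt hk h hC (Finset.mem_range.1 hs) (Finset.mem_range.1 hr)
  · rw [Finset.card_product, Finset.card_range, Finset.card_range, nsmul_eq_mul]
    push_cast
    ring

theorem setBernoulli_isUnavoidable_le [Nontrivial κ] (hℓ : 0 < ℓ) (hk : ℓ + 2 ≤ k)
    (hC : ∀ τ, IsTight (C τ)) (L : ℕ) {p : unitInterval} (h : IsScale κ k ℓ n p y c) :
    setBernoulli (Set.Icc 1 n) p {S | IsUnavoidable vert Prod.fst (solutionsIn C b n S)} ≤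
      ENNReal.ofReal (expectationBound (Fintype.card κ) k ℓ L y) := by
  let costly := (Finset.range (2 * L + 10) ×ˢ Finset.range 5).sigma fun i =>
    costlyStates C b n i.1 i.2
  have hsub : {S | IsUnavoidable vert Prod.fst (solutionsIn C b n S)} ⊆
      {S : Set ℕ | ∃ t ∈ states C b n L 0, (t.explored : Set ℕ) ⊆ S} ∪
        {S | ∃ a ∈ costly, (a.2.explored : Set ℕ) ⊆ S} := by
    intro S hS
    refine (exists_state_of_isUnavoidable hℓ (by omega) hC L hS).imp_right ?_
    rintro ⟨s, hs, r, hr, t, ht, htS⟩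
    exact ⟨⟨(s, r), t⟩, Finset.mem_sigma.2 ⟨Finset.mk_mem_product (Finset.mem_range.2 hs)
      (Finset.mem_range.2 hr), ht⟩, htS⟩
  calc _ ≤ _ := (measure_mono hsub).trans (measure_union_le _ _)
    _ ≤ ENNReal.ofReal (∑ t ∈ states C b n L 0, (p : ℝ) ^ t.explored.card) +
          ENNReal.ofReal (∑ a ∈ costly, (p : ℝ) ^ a.2.explored.card) :=
        add_le_add (setBernoulli_exists_superset_le _ p _ _)
          (setBernoulli_exists_superset_le _ p costly fun a => a.2.explored)
    _ ≤ _ := by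
        rw [← ENNReal.ofReal_add (Finset.sum_nonneg fun t _ => pow_nonneg h.nonneg _)
          (Finset.sum_nonneg fun t _ => pow_nonneg h.nonneg _), Finset.sum_sigma]
        exact ENNReal.ofReal_le_ofReal
          (sum_pow_card_states_add_sum_costlyStates_le (by omega) h hC L)

end FirstMoment

end RadoHypergraph

namespace RadoHypergraph

open RadoMatrix MeasureTheory ProbabilityTheory

section Limit

variable {k ℓ : ℕ}

theorem tendsto_ceil_log_pow_div_rpow (K : ℝ) (D : ℕ) {a : ℝ} (ha : 0 < a) :
    Tendsto (fun n : ℕ => K * (2 * (⌈Real.log n⌉₊ : ℝ) + 10) ^ D / (n : ℝ) ^ a) atTop (𝓝 0) := by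
  have hlog : Tendsto (fun n : ℕ => Real.log n ^ D / (n : ℝ) ^ a) atTop (𝓝 0) := by
    simpa [Function.comp_def] using
      ((isLittleO_log_rpow_rpow_atTop (D : ℝ) ha).tendsto_div_nhds_zero).comp
        tendsto_natCast_atTop_atTop
  have hceil : Tendsto (fun n : ℕ => (2 * (⌈Real.log n⌉₊ : ℝ) + 10) ^ D / (n : ℝ) ^ a)
      atTop (𝓝 0) := by
    refine squeeze_zero' (Eventually.of_forall fun n => by positivity) ?_
      (by simpa using hlog.const_mul ((14 : ℝ) ^ D))
    filter_upwards [eventually_ge_atTop 3] with n hn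
    have hlog_ge : 1 ≤ Real.log n := by
      rw [Real.le_log_iff_exp_le (by positivity)]
      have : (3 : ℝ) ≤ n := by exact_mod_cast hn
      linarith [Real.exp_one_lt_d9]
    have := (Nat.ceil_lt_add_one (zero_le_one.trans hlog_ge)).le
    rw [← mul_div_assoc, ← mul_pow]
    gcongr
    linarith
  simpa [mul_div_assoc] using hceil.const_mul K

theorem exp_neg_one_pow_ceil_log_le {n : ℕ} (hn : 0 < n) :
    Real.exp (-1) ^ ⌈Real.log n⌉₊ ≤ (n : ℝ)⁻¹ := by
  have hn0 : (0 : ℝ) < n := Nat.cast_pos.2 hn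
  rw [← Real.exp_nat_mul, mul_neg_one, Real.exp_neg]
  gcongr
  exact (Real.log_le_iff_le_exp hn0).1 (Nat.le_ceil _)

theorem tendsto_rpow_pow_mul_exp_neg_one_pow (K : ℝ) {a : ℝ} (ha : a * ℓ < 1) :
    Tendsto (fun n : ℕ => K * ((n : ℝ) ^ a) ^ ℓ * Real.exp (-1) ^ ⌈Real.log n⌉₊)
      atTop (𝓝 0) := by
  have hlim : Tendsto (fun n : ℕ => (n : ℝ) ^ (-(1 - a * ℓ))) atTop (𝓝 0) :=
    (tendsto_rpow_neg_atTop (sub_pos.2 ha)).comp tendsto_natCast_atTop_atTop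
  have hpow : Tendsto (fun n : ℕ => ((n : ℝ) ^ a) ^ ℓ * Real.exp (-1) ^ ⌈Real.log n⌉₊)
      atTop (𝓝 0) := by
    refine squeeze_zero' (Eventually.of_forall fun n => by positivity) ?_ hlim
    filter_upwards [eventually_gt_atTop 0] with n hn
    have hn0 : (0 : ℝ) < n := Nat.cast_pos.2 hn
    calc ((n : ℝ) ^ a) ^ ℓ * Real.exp (-1) ^ ⌈Real.log n⌉₊
        ≤ ((n : ℝ) ^ a) ^ ℓ * (n : ℝ)⁻¹ := by
          gcongr
          exact exp_neg_one_pow_ceil_log_le hn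
      _ = (n : ℝ) ^ (-(1 - a * ℓ)) := by
          rw [← Real.rpow_mul_natCast hn0.le, ← Real.rpow_neg_one, ← Real.rpow_add hn0]
          congr 1
          ring
  simpa [mul_assoc] using hpow.const_mul K

theorem tendsto_expectationBound (K : ℕ) (hk : ℓ + 2 ≤ k) :
    Tendsto (fun n : ℕ => expectationBound K k ℓ ⌈Real.log n⌉₊ ((n : ℝ) ^ (1 / ((k : ℝ) - 1))))
      atTop (𝓝 0) := by
  have hkR : (ℓ : ℝ) + 2 ≤ k := by exact_mod_cast hk
  have hk1 : (0 : ℝ) < (k : ℝ) - 1 := by linarith [(Nat.cast_nonneg ℓ : (0 : ℝ) ≤ ℓ)]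
  have hpaths := tendsto_rpow_pow_mul_exp_neg_one_pow (ℓ := ℓ) K (a := 1 / ((k : ℝ) - 1))
    (by rw [one_div_mul_eq_div, div_lt_one hk1]; linarith)
  have hcostly := tendsto_ceil_log_pow_div_rpow (5 * (K * (K * (2 ^ k * (k : ℝ) ^ k)) ^ 4))
    (1 + 4 * (1 + k)) (one_div_pos.2 hk1)
  rw [← add_zero (0 : ℝ)]
  refine hpaths.add (hcostly.congr fun n => ?_)
  generalize 2 * (⌈Real.log n⌉₊ : ℝ) + 10 = T
  ring

variable {κ : Type*} [Fintype κ]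

theorem isScale_of_le [Nonempty κ] (hk : ℓ + 2 ≤ k) {n : ℕ} (hn : 0 < n) {p : ℝ} (hp0 : 0 ≤ p)
    (hp : p ≤ 1 / (3 * Fintype.card κ * k ^ 2) * (n : ℝ) ^ (-(((k : ℝ) - ℓ - 1) / ((k : ℝ) - 1)))) :
    IsScale κ k ℓ n p ((n : ℝ) ^ (1 / ((k : ℝ) - 1))) (1 / (3 * Fintype.card κ * k ^ 2)) := by
  have hkR : (ℓ : ℝ) + 2 ≤ k := by exact_mod_cast hk
  have hk1 : (0 : ℝ) < (k : ℝ) - 1 := by linarith [(Nat.cast_nonneg ℓ : (0 : ℝ) ≤ ℓ)]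
  have hk0 : (0 : ℝ) < k := by linarith
  have hk1' : ((k - 1 : ℕ) : ℝ) = (k : ℝ) - 1 := by rw [Nat.cast_sub (by omega), Nat.cast_one]
  have hn0 : (0 : ℝ) < n := Nat.cast_pos.2 hn
  have hκ : (1 : ℝ) ≤ Fintype.card κ := by exact_mod_cast Fintype.card_pos (α := κ)
  set c : ℝ := 1 / (3 * Fintype.card κ * k ^ 2) with hc
  have hc0 : 0 < c := by positivity
  have hc1 : c ≤ 1 := by
    rw [hc, div_le_one (by positivity)]
    nlinarith
  refine ⟨hp0, Real.one_le_rpow (by exact_mod_cast hn) (one_div_pos.2 hk1).le, ?_, ?_, hc1, ?_⟩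
  · rw [← Real.rpow_mul_natCast hn0.le, hk1', one_div_mul_cancel hk1.ne', Real.rpow_one]
  · calc p * ((n : ℝ) ^ (1 / ((k : ℝ) - 1))) ^ (k - 1 - ℓ)
        ≤ c * (n : ℝ) ^ (-(((k : ℝ) - ℓ - 1) / ((k : ℝ) - 1))) *
          ((n : ℝ) ^ (1 / ((k : ℝ) - 1))) ^ (k - 1 - ℓ) := by gcongr
      _ = c * (n : ℝ) ^ (0 : ℝ) := by
          rw [← Real.rpow_mul_natCast hn0.le, mul_assoc, ← Real.rpow_add hn0,
            Nat.cast_sub (by omega), hk1']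
          congr 2
          ring
      _ = c := by rw [Real.rpow_zero, mul_one]
  · calc (Fintype.card κ : ℝ) * (k * (k * c ^ (k - 1))) ≤ Fintype.card κ * (k * (k * c)) := by
          gcongr
          exact pow_le_of_le_one hc0.le hc1 (by omega)
      _ = 3⁻¹ := by
          rw [hc]
          field_simp
      _ ≤ Real.exp (-1) := by
          rw [Real.exp_neg]
          gcongr
          linarith [Real.exp_one_lt_d9]

theorem tendsto_setBernoulli_isUnavoidable [Nontrivial κ] (hℓ : 0 < ℓ) (hk : ℓ + 2 ≤ k)
    {C : κ → Matrix (Fin ℓ) (Fin k) ℤ} (hC : ∀ τ, IsTight (C τ)) (b : κ → Fin ℓ → ℚ)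
    {p : ℕ → unitInterval}
    (hp : ∀ᶠ n : ℕ in atTop, (p n : ℝ) ≤
      1 / (3 * Fintype.card κ * k ^ 2) * (n : ℝ) ^ (-(((k : ℝ) - ℓ - 1) / ((k : ℝ) - 1)))) :
    Tendsto (fun n : ℕ => setBernoulli (Set.Icc 1 n) (p n)
      {S | IsUnavoidable vert Prod.fst (solutionsIn C b n S)}) atTop (𝓝 0) := by
  have hbound := ENNReal.tendsto_ofReal (tendsto_expectationBound (Fintype.card κ) hk)
  rw [ENNReal.ofReal_zero] at hbound
  refine tendsto_of_tendsto_of_tendsto_of_le_of_le' tendsto_const_nhds hbound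
    (Eventually.of_forall fun _ => zero_le) ?_
  filter_upwards [hp, eventually_gt_atTop 0] with n hpn hn
  exact setBernoulli_isUnavoidable_le hℓ hk hC _ (isScale_of_le hk hn (p n).2.1 hpn)

end Limit

end RadoHypergraph

namespace RadoMatrix

section Core

variable {k ℓ : ℕ} {A : LinearSystem} {C : Matrix (Fin ℓ) (Fin k) ℤ}

theorem IsCore.exists_rhs (h : IsCore A.matrix C) :
    ∃ (b : Fin ℓ → ℚ) (σ : Fin k ↪ Fin A.cols), ∀ x : Fin A.cols → ℕ,
      A.matrix.mulVec (fun j => (x j : ℤ)) = A.rhs →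
        (toRat C).mulVec (fun j => (x (σ j) : ℚ)) = b := by
  obtain ⟨⟨U, -, ρ, σ, hC, hzero⟩, -⟩ := h
  refine ⟨fun i => U.mulVec (fun r => (A.rhs r : ℚ)) (ρ i), σ.toEmbedding, fun x hx => ?_⟩
  have hxRat : (toRat A.matrix).mulVec (fun j => (x j : ℚ)) = fun r => (A.rhs r : ℚ) := by
    ext r
    rw [← hx]
    simp [toRat, Matrix.mulVec, dotProduct]
  ext i
  rw [← hxRat, Matrix.mulVec_mulVec, hC]
  simp only [Matrix.mulVec, dotProduct, Matrix.submatrix_apply]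
  refine (Finset.sum_map Finset.univ σ.toEmbedding
    (fun j => (U * toRat A.matrix) (ρ i) j * (x j : ℚ))).symm.trans ?_
  refine Finset.sum_subset (Finset.subset_univ _) fun j _ hj => ?_
  rw [hzero i j (by simpa using hj), zero_mul]

theorem IsCore.isTight {ℓ' k' : ℕ} {M : Matrix (Fin ℓ') (Fin k') ℤ} (h : IsCore M C)
    (hk : ℓ + 2 ≤ k) (hM : PropertyStar M) : IsTight C :=
  h.2.2.1.isTight hk (h.rowStar hM.rowStar) h.2.1

theorem IsCore.m_eq {ℓ' k' : ℕ} {M : Matrix (Fin ℓ') (Fin k') ℤ} (h : IsCore M C) (hk : 2 ≤ k) :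
    m M = ((k : ℝ) - 1) / ((k : ℝ) - 1 - ℓ) :=
  h.2.2.2.symm.trans (h.2.2.1.m_eq hk)

theorem IsCore.one_div_mPair_eq {ℓ₁ k₁ ℓ₂ k₂ : ℕ} {M : Matrix (Fin ℓ₁) (Fin k₁) ℤ}
    {N : Matrix (Fin ℓ₂) (Fin k₂) ℤ} {D : Matrix (Fin ℓ) (Fin k) ℤ} (hC : IsCore M C)
    (hD : IsCore N D) (hk : ℓ + 2 ≤ k) (hM : PropertyStar M)
    (hirr : (LinearSystem.homogeneous M).Irredundant) :
    1 / mPair M N = ((k : ℝ) - ℓ - 1) / ((k : ℝ) - 1) := by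
  have hkR : (ℓ : ℝ) + 2 ≤ k := by exact_mod_cast hk
  have : (0 : ℝ) ≤ ℓ := Nat.cast_nonneg ℓ
  obtain ⟨⟨-, -, -, σ, -⟩, -⟩ := id hC
  have hcols : k ≤ k₁ := by simpa using Fintype.card_le_of_embedding σ.toEmbedding
  rw [mPair_eq_of_m_eq (by omega) hM.rowStar hirr (div_pos (by linarith) (by linarith))
    (hC.m_eq (by omega)) (hD.m_eq (by omega)), one_div_div, sub_right_comm]

end Core

end RadoMatrix

namespace RadoHypergraph

open RadoMatrix

theorem isUnavoidable_of_isRado {r k ℓ n : ℕ} {A : Fin r → LinearSystem}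
    {C : Fin r → Matrix (Fin ℓ) (Fin k) ℤ} {b : Fin r → Fin ℓ → ℚ}
    {σ : ∀ i, Fin k ↪ Fin (A i).cols}
    (hσ : ∀ i, ∀ x : Fin (A i).cols → ℕ, (A i).matrix.mulVec (fun j => (x j : ℤ)) = (A i).rhs →
      (toRat (C i)).mulVec (fun j => (x (σ i j) : ℚ)) = b i)
    {S : Set ℕ} (hS : S ⊆ Set.Icc 1 n) (h : LinearSystem.IsRado A S) :
    IsUnavoidable vert Prod.fst (solutionsIn C b n S) := by
  intro χ
  obtain ⟨i, x, ⟨hxS, hinj, hx⟩, hχ⟩ := h χ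
  refine ⟨(i, fun j => x (σ i j)), ⟨mem_solutions.2 ⟨fun j => Finset.mem_Icc.2 (hS (hxS _)),
    hinj.comp (σ i).injective, hσ i x hx⟩, fun v hv => ?_⟩, fun v hv => ?_⟩
  · obtain ⟨j, rfl⟩ := mem_vert.1 (Finset.mem_coe.1 hv)
    exact hxS _
  · obtain ⟨j, rfl⟩ := mem_vert.1 hv
    exact hχ _

end RadoHypergraph

open RadoMatrix RadoHypergraph in
theorem theorem3p1_general (k ℓ r : ℕ) (hℓ : 0 < ℓ) (hk : ℓ + 2 ≤ k) (hr : 2 ≤ r) :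
    ∃ c : ℝ, 0 < c ∧
      ∀ A : Fin r → LinearSystem,
        (∀ i, (LinearSystem.homogeneous (A i).matrix).Irredundant) →
        (∀ i, PropertyStar (A i).matrix) →
        (∀ i, ∃ C : Matrix (Fin ℓ) (Fin k) ℤ, IsCore (A i).matrix C) →
        (∀ i j, 1 / mPair (A i).matrix (A j).matrix = ((k : ℝ) - ℓ - 1) / ((k : ℝ) - 1)) ∧
        ∀ p : ℕ → unitInterval,
          (∀ᶠ n : ℕ in atTop,
            (p n : ℝ) ≤ c * (n : ℝ) ^ (-(((k : ℝ) - ℓ - 1) / ((k : ℝ) - 1)))) →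
          Tendsto
            (fun n : ℕ =>
              ProbabilityTheory.setBernoulli (Set.Icc 1 n) (p n)
                {S : Set ℕ | LinearSystem.IsRado A S})
            atTop (𝓝 0) := by
  have : Nontrivial (Fin r) := Fin.nontrivial_iff_two_le.2 hr
  have hk0 : 0 < k := by omega
  refine ⟨1 / (3 * Fintype.card (Fin r) * k ^ 2), by positivity, fun A hirr hstar hcore => ?_⟩
  choose C hC using hcore
  refine ⟨fun i j => (hC i).one_div_mPair_eq (hC j) hk (hstar i) (hirr i), fun p hp => ?_⟩
  choose b σ hσ using fun i => (hC i).exists_rhs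
  refine tendsto_of_tendsto_of_tendsto_of_le_of_le tendsto_const_nhds
    (tendsto_setBernoulli_isUnavoidable hℓ hk (fun i => (hC i).isTight hk (hstar i)) b hp)
    (fun _ => zero_le) fun n => ?_
  dsimp only
  rw [ProbabilityTheory.setBernoulli_apply_eq_apply_subsets]
  exact MeasureTheory.measure_mono fun S hS => isUnavoidable_of_isRado hσ hS.2 hS.1

theorem theorem3p1 (k ℓ : ℕ) (hℓ : 0 < ℓ) (hk : ℓ + 2 ≤ k) :
    ∃ c : ℝ, 0 < c ∧
      ∀ A B : LinearSystem,
        A.Irredundant → B.Irredundant →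
        (LinearSystem.homogeneous A.matrix).Irredundant →
        (LinearSystem.homogeneous B.matrix).Irredundant →
        RadoMatrix.PropertyStar A.matrix → RadoMatrix.PropertyStar B.matrix →
        (∃ C : Matrix (Fin ℓ) (Fin k) ℤ, RadoMatrix.IsCore A.matrix C) →
        (∃ C : Matrix (Fin ℓ) (Fin k) ℤ, RadoMatrix.IsCore B.matrix C) →
        1 / RadoMatrix.mPair A.matrix B.matrix = ((k : ℝ) - ℓ - 1) / ((k : ℝ) - 1) ∧
        ∀ p : ℕ → unitInterval,
          (∀ᶠ n : ℕ in atTop,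
            (p n : ℝ) ≤ c * (n : ℝ) ^ (-(((k : ℝ) - ℓ - 1) / ((k : ℝ) - 1)))) →
          Tendsto
            (fun n : ℕ =>
              ProbabilityTheory.setBernoulli (Set.Icc 1 n) (p n)
                {S : Set ℕ | LinearSystem.IsRado ![A, B] S})
            atTop (𝓝 0) := by
  obtain ⟨c, hc, h⟩ := theorem3p1_general k ℓ 2 hℓ hk le_rfl
  refine ⟨c, hc, fun A B _ _ hA hB hAstar hBstar hAcore hBcore => ?_⟩
  obtain ⟨hm, hlim⟩ := h ![A, B] (Fin.forall_fin_two.2 ⟨hA, hB⟩)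
    (Fin.forall_fin_two.2 ⟨hAstar, hBstar⟩) (Fin.forall_fin_two.2 ⟨hAcore, hBcore⟩)
  exact ⟨hm 0 1, hlim⟩
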